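/- Call a subset $X$ of a partially ordered set (poset) $P$ *$k$-linked* if every $k$-element subset of $X$ has a common lower bound in $P$. A poset is *$\sigma$-$k$-linked* if it is a union of countably many $k$-linked subsets, and it has *property $\mathrm{K}_k$* if each of its uncountable subsets has an uncountable $k$-linked subset. For $n\ge 2$, let $\mathrm{MA}_{\omega_1}(\sigma\text{-}n\text{-linked})$ be the assertion that for every nonempty $\sigma$-$n$-linked poset $P$ and every family $\mathcal D$ of at most $\omega_1$ dense (i.e. downward cofinal) subsets of $P$ there is a filter $G\subseteq P$ (a nonempty upward closed set in which any two elements have a common lower bound belonging to $G$) such that $G\cap D\ne\emptyset$ for all $D\in\mathcal D$. **Theorem.** Let $n\ge 2$ be an integer. If every $\sigma$-$n$-linked poset has property $\mathrm{K}_{n+1}$, then $\mathrm{MA}_{\omega_1}(\sigma\text{-}n\text{-linked})$ holds. In particular, if every $\sigma$-$n$-linked poset of cardinality $\omega_1$ is $\sigma$-$(n+1)$-linked, then $\mathrm{MA}_{\omega_1}(\sigma\text{-}n\text{-linked})$ holds. -/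

import Mathlib

open scoped Cardinal

universe u

namespace PosetProp

/-- A subset `X` of a poset is `n`-linked if every `n`-element subset of `X` has a common lower
bound in the poset. -/
def IsLinked {P : Type u} [PartialOrder P] (n : ℕ) (X : Set P) : Prop :=
  ∀ s : Finset P, (s : Set P) ⊆ X → s.card = n → ∃ q : P, ∀ p ∈ s, q ≤ p

/-- Property `K_n`: every uncountable subset has an uncountable `n`-linked subset. -/
def Knaster (n : ℕ) (P : Type u) [PartialOrder P] : Prop :=
  ∀ X : Set P, ¬ X.Countable → ∃ Y : Set P, Y ⊆ X ∧ ¬ Y.Countable ∧ IsLinked n Y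

/-- A poset is `σ`-`n`-linked if it is a countable union of `n`-linked subsets. -/
def SigmaLinked (n : ℕ) (P : Type u) [PartialOrder P] : Prop :=
  ∃ A : ℕ → Set P, (∀ m, IsLinked n (A m)) ∧ (⋃ m, A m) = Set.univ

/-- A subset of a poset is dense if it is downward cofinal. -/
def IsDense {P : Type u} [PartialOrder P] (D : Set P) : Prop :=
  ∀ p : P, ∃ q ∈ D, q ≤ p

/-- `P(Φ → Ψ)`: every poset with property `Φ` has property `Ψ`. -/
def Implies (Φ Ψ : (P : Type u) → [PartialOrder P] → Prop) : Prop :=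
  ∀ (P : Type u) [PartialOrder P], Φ P → Ψ P

/-- `P_{ω₁}(Φ → Ψ)`: every poset of size `ω₁` with property `Φ` has property `Ψ`. -/
def ImpliesOmegaOne (Φ Ψ : (P : Type u) → [PartialOrder P] → Prop) : Prop :=
  ∀ (P : Type u) [PartialOrder P], #P = ℵ₁ → Φ P → Ψ P

/-- `MA_{ω₁}(Φ)`, for a property `Φ` of posets that implies the countable chain condition: for
every nonempty poset with property `Φ` and every family of at most `ω₁` dense subsets, there is a
filter (nonempty, upward closed, downward directed) that meets every member of the family. -/
def MartinAxiomOmegaOne (Φ : (P : Type u) → [PartialOrder P] → Prop) : Prop :=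
  ∀ (P : Type u) [PartialOrder P] [Nonempty P], Φ P →
    ∀ 𝒟 : Set (Set P), #𝒟 ≤ ℵ₁ → (∀ D ∈ 𝒟, IsDense D) →
      ∃ G : Order.PFilter P, ∀ D ∈ 𝒟, ((G : Set P) ∩ D).Nonempty

end PosetProp

namespace PosetProp

/-! Either hypothesis gives property K_{n+1} for the σ-n-linked posets of size ω₁, and nothing else
is used. It is applied to families Φ of finite sets ordered by reverse inclusion: if Φ splits into
countably many classes such that n members of one class have their union in Φ, there is an
uncountable Y whose subsets of size at most n + 1 lie in Φ (`IsLinkedComplex.exists_uncountable`).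

The heart is the passage from n + 1 to all finite sizes (`IsLinkedComplex.exists_homogeneous`). The
order of ω₁ is an increasing union of tree orders with finite chains `F k α` of predecessors, and
each finite set is a chain in some tree. Points get types, which are isomorphism types of these
chains labelled by Φ. One use of K_{n+1} yields an uncountable X with finitely many types in each
tree, so that types can be refined until points of equal type can be amalgamated with the same types
of successors. A second use concerns the sets generated from singletons by uniting n copies of a
set. If all subsets of size at most n + 1 are generated, so is the whole set
(`TypeSystem.generated_of_card_le`), and generated sets lie in Φ.

A complex of sets with prescribed lower bounds then shows that σ-n-linked posets of size ω₁ are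
σ-centered (`SigmaLinked.exists_isCentered`). Narrow sets of types also bound ω₁ functions
(`exists_eventually_le`) and choose values from ω₁ coherent sequences of sets
(`exists_eventually_mem`). Together these produce a centered set meeting ω₁ dense sets
(`exists_centered_meeting`). A closure argument reduces arbitrary posets to size ω₁. -/

/-- Every poset of size `ω₁` that is `σ`-`n`-linked has property `K_{n+1}`. -/
def KnasterOmegaOne (n : ℕ) : Prop :=
  ImpliesOmegaOne.{u} (SigmaLinked n) (Knaster (n + 1))

theorem Implies.knasterOmegaOne {n : ℕ}
    (h : Implies.{u} (SigmaLinked n) (Knaster (n + 1))) : KnasterOmegaOne.{u} n :=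
  fun P _ _ hP => h P hP

theorem SigmaLinked.knaster {n : ℕ} {P : Type u} [PartialOrder P] (h : SigmaLinked n P) :
    Knaster n P := by
  obtain ⟨A, hA, hU⟩ := h
  intro X hX
  by_contra hcon
  push Not at hcon
  refine hX ((Set.countable_iUnion (t := fun m => X ∩ A m) fun m => ?_).mono ?_)
  · by_contra hm
    exact hcon _ Set.inter_subset_left hm fun s hs hc =>
      hA m s (hs.trans Set.inter_subset_right) hc
  · intro p hp
    obtain ⟨m, hm⟩ := Set.mem_iUnion.1 (hU.ge (Set.mem_univ p))
    exact Set.mem_iUnion.2 ⟨m, hp, hm⟩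

theorem ImpliesOmegaOne.knasterOmegaOne {n : ℕ}
    (h : ImpliesOmegaOne.{u} (SigmaLinked n) (SigmaLinked (n + 1))) : KnasterOmegaOne.{u} n :=
  fun P _ hc hP => (h P hc hP).knaster

/-! ### Complexes of finite sets -/

/-- A family of finite sets, closed under subsets, that is a countable union of classes such that
the union of any `n` members of one class belongs to the family. -/
structure IsLinkedComplex (n : ℕ) {J : Type u} (Φ : Finset J → Prop) : Prop where
  empty : Φ ∅
  singleton : ∀ a, Φ {a}
  mono : ∀ {x y}, Φ y → x ⊆ y → Φ x
  exists_class : ∃ c : Finset J → ℕ, ∀ x : Fin n → Finset J, (∀ e, Φ (x e)) →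
    (∀ e e', c (x e) = c (x e')) → ∀ z : Finset J, (∀ u ∈ z, ∃ e, u ∈ x e) → Φ z

/-- Classes may overlap: some code is chosen for each nonempty member, and the empty set gets a
class of its own. -/
theorem IsLinkedComplex.of_rel {n : ℕ} {J : Type u} {Φ : Finset J → Prop} (empty : Φ ∅)
    (singleton : ∀ a, Φ {a}) (mono : ∀ {x y}, Φ y → x ⊆ y → Φ x) {C : Type*} [Countable C]
    (R : Finset J → C → Prop) (hR : ∀ x, Φ x → x.Nonempty → ∃ c, R x c)
    (hU : ∀ c (x : Fin n → Finset J), (∀ e, Φ (x e)) → (∀ e, (x e).Nonempty) →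
      (∀ e, R (x e) c) → ∀ z : Finset J, z.Nonempty → (∀ u ∈ z, ∃ e, u ∈ x e) → Φ z) :
    IsLinkedComplex n Φ := by
  classical
  refine ⟨empty, singleton, mono, ?_⟩
  obtain ⟨f, hf⟩ := Countable.exists_injective_nat (Option C)
  refine ⟨fun x => f (if h : Φ x ∧ x.Nonempty then some (hR x h.1 h.2).choose else none), ?_⟩
  intro x hx hc z hz
  rcases z.eq_empty_or_nonempty with rfl | hzn
  · exact empty
  obtain ⟨u, hu⟩ := hzn
  obtain ⟨e, he⟩ := hz u hu
  have hne : ∀ e', (x e').Nonempty := by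
    intro e'
    by_contra h
    have := hf (hc e e')
    rw [dif_pos ⟨hx e, ⟨u, he⟩⟩, dif_neg (fun h' => h h'.2)] at this
    cases this
  refine hU (hR (x e) (hx e) (hne e)).choose x hx hne (fun e' => ?_) z ⟨u, hu⟩ hz
  have := hf (hc e e')
  rw [dif_pos ⟨hx e, hne e⟩, dif_pos ⟨hx e', hne e'⟩] at this
  rw [Option.some.inj this]
  exact (hR (x e') (hx e') (hne e')).choose_spec

theorem IsLinkedComplex.exists_uncountable {n : ℕ} (H : KnasterOmegaOne.{u} n) {J : Type u}
    (hJ : #J = ℵ₁) {Φ : Finset J → Prop} (hΦ : IsLinkedComplex n Φ) :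
    ∃ Y : Set J, ¬ Y.Countable ∧ ∀ W : Finset J, (W : Set J) ⊆ Y → W.card ≤ n + 1 → Φ W := by
  classical
  have hJinf : Infinite J := by
    rw [Cardinal.infinite_iff, hJ]; exact Cardinal.aleph0_le_aleph 1
  let Q : Type u := {z : Finset J // Φ z}ᵒᵈ
  let g : J → Q := fun a => OrderDual.toDual ⟨{a}, hΦ.singleton a⟩
  have hg : Function.Injective g := fun a b h =>
    Finset.singleton_injective (congrArg (fun q : Q => (OrderDual.ofDual q).1) h)
  have hQ : #Q = ℵ₁ := by
    refine le_antisymm ?_ (hJ ▸ Cardinal.mk_le_of_injective hg)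
    calc #Q ≤ #(Finset J) :=
          Cardinal.mk_le_of_injective (f := fun q : Q => (OrderDual.ofDual q).1)
            (fun a b h => Subtype.ext h)
      _ = ℵ₁ := by rw [Cardinal.mk_finset_of_infinite, hJ]
  obtain ⟨c, hc⟩ := hΦ.exists_class
  have hlinked : SigmaLinked n Q := by
    refine ⟨fun m => {q | c (OrderDual.ofDual q).1 = m}, fun m s hs hcard => ?_, ?_⟩
    · let e := s.equivFinOfCardEq hcard
      have h := hc (fun i => (OrderDual.ofDual (e.symm i).1).1)
        (fun i => (OrderDual.ofDual (e.symm i).1).2)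
        (fun i j => (hs (e.symm i).2).trans (hs (e.symm j).2).symm)
        (s.biUnion fun q => (OrderDual.ofDual q).1) (by
          intro u hu
          obtain ⟨q, hq, hu⟩ := Finset.mem_biUnion.1 hu
          exact ⟨e ⟨q, hq⟩, by simpa using hu⟩)
      exact ⟨OrderDual.toDual ⟨_, h⟩, fun p hp =>
        Finset.subset_biUnion_of_mem (fun q : Q => (OrderDual.ofDual q).1) hp⟩
    · ext q; simp
  obtain ⟨Y', hY'X, hY', hY'l⟩ := H Q hQ hlinked (Set.range g) (by
    intro h
    have := h.preimage hg
    rw [Set.preimage_range, Set.countable_univ_iff, ← Cardinal.mk_le_aleph0_iff, hJ] at this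
    exact absurd this (not_le.2 Cardinal.aleph0_lt_aleph_one))
  have hY : ¬ (g ⁻¹' Y').Countable := fun h => hY' ((h.image g).mono (by
    rw [Set.image_preimage_eq_of_subset hY'X]))
  refine ⟨g ⁻¹' Y', hY, fun W hW hcard => ?_⟩
  have hinf : (g ⁻¹' Y').Infinite := fun h => hY h.countable
  -- Linkedness speaks of exactly n + 1 elements, so a smaller set is first enlarged inside the
  -- infinite Y.
  obtain ⟨W', hWW', hW'Y, hW'⟩ :
      ∃ W' : Finset J, W ⊆ W' ∧ (W' : Set J) ⊆ g ⁻¹' Y' ∧ W'.card = n + 1 := by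
    obtain ⟨V, hV, hVc⟩ := hinf.exists_subset_card_eq (n + 1)
    obtain ⟨W', h1, h2, h3⟩ := Finset.exists_subsuperset_card_eq
      (Finset.subset_union_left : W ⊆ W ∪ V) hcard
      (hVc ▸ Finset.card_le_card Finset.subset_union_right)
    refine ⟨W', h1, fun a ha => ?_, h3⟩
    rcases Finset.mem_union.1 (h2 ha) with h | h
    exacts [hW h, hV h]
  obtain ⟨q, hq⟩ := hY'l (W'.image g) (by
    intro p hp
    obtain ⟨a, ha, rfl⟩ := Finset.mem_image.1 (Finset.mem_coe.1 hp)
    exact hW'Y ha) (by rw [Finset.card_image_of_injective _ hg, hW'])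
  refine hΦ.mono (OrderDual.ofDual q).2 fun a ha => ?_
  have : (OrderDual.ofDual (g a)).1 ⊆ (OrderDual.ofDual q).1 :=
    hq (g a) (Finset.mem_image_of_mem g (hWW' ha))
  exact this (Finset.mem_singleton_self a)

/-! ### Coherent systems of finite chains -/

/-- For every `k`, the finite set `F k α` of predecessors of `α` is an initial segment of a
coherent approximation of the order by trees of height at most `k + 1`. -/
structure CoherentSystem (I : Type u) [LinearOrder I] where
  F : ℕ → I → Finset I
  self_mem : ∀ k α, α ∈ F k α
  le_of_mem : ∀ {k α β}, β ∈ F k α → β ≤ α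
  mono : ∀ {k l} α, k ≤ l → F k α ⊆ F l α
  exists_mem : ∀ {α β}, β ≤ α → ∃ k, β ∈ F k α
  mem_iff : ∀ {k α β}, β ∈ F k α → ∀ γ, γ ∈ F k β ↔ γ ∈ F k α ∧ γ ≤ β
  card_le : ∀ k α, (F k α).card ≤ k + 1

theorem exists_of_wellFounded_step {I : Type*} [LT I] [WellFoundedLT I] {T : Type*} [Inhabited T]
    (Good : I → (I → T) → T → Prop)
    (hloc : ∀ α G G' t, (∀ β < α, G β = G' β) → Good α G t → Good α G' t)
    (hstep : ∀ α G, (∀ β < α, Good β G (G β)) → ∃ t, Good α G t) :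
    ∃ G : I → T, ∀ α, Good α G (G α) := by
  classical
  let ext (α : I) (f : ∀ β, β < α → T) : I → T := fun β => if h : β < α then f β h else default
  let step (α : I) (f : ∀ β, β < α → T) : T :=
    if h : ∃ t, Good α (ext α f) t then h.choose else default
  let G : I → T := (wellFounded_lt (α := I)).fix step
  have hG : ∀ α, G α = step α fun β _ => G β := fun α => WellFounded.fix_eq _ _ _
  refine ⟨G, fun α => ?_⟩
  induction α using WellFoundedLT.induction with
  | _ α ih =>
    have heq : ∀ β < α, ext α (fun β _ => G β) β = G β := fun β h => dif_pos h
    have hex : ∃ t, Good α (ext α fun β _ => G β) t := by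
      obtain ⟨t, ht⟩ := hstep α G ih
      exact ⟨t, hloc α _ _ t (fun β h => (heq β h).symm) ht⟩
    have : Good α (ext α fun β _ => G β) (G α) := by
      rw [hG α]
      simp only [step]
      rw [dif_pos hex]
      exact hex.choose_spec
    exact hloc α _ _ _ heq this

theorem exists_monotone_cofinal_Iio {I : Type*} [LinearOrder I] {α : I}
    (hc : (Set.Iio α).Countable) (hne : (Set.Iio α).Nonempty) :
    ∃ a : ℕ → I, Monotone a ∧ (∀ n, a n < α) ∧ ∀ β < α, ∃ n, β ≤ a n := by
  obtain ⟨s, hs⟩ := hc.exists_eq_range hne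
  refine ⟨partialSups s, (partialSups s).monotone, fun n => ?_, fun β hβ => ?_⟩
  · have h : ∀ n, s n < α := fun n => hs.ge (Set.mem_range_self n)
    induction n with
    | zero => simpa using h 0
    | succ n ih => rw [← Order.succ_eq_add_one, partialSups_succ]; exact max_lt ih (h _)
  · obtain ⟨n, rfl⟩ := hs.le hβ
    exact ⟨n, le_partialSups s n⟩

/-- `g` is a possible value at `α` of a coherent system (without the diagonal) that is given by
`G` below `α`. -/
structure IsCoherentAt {I : Type u} [LinearOrder I] (α : I) (G : I → ℕ → Finset I)
    (g : ℕ → Finset I) : Prop where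
  lt_of_mem : ∀ {k β}, β ∈ g k → β < α
  mono : Monotone g
  exists_mem : ∀ {β}, β < α → ∃ k, β ∈ g k
  mem_iff : ∀ {k β}, β ∈ g k → ∀ γ, γ ∈ G β k ↔ γ ∈ g k ∧ γ < β
  card_le : ∀ k, (g k).card ≤ k
  slack : ∀ m, ∃ k₀, ∀ k ≥ k₀, (g k).card + m ≤ k

/-- Along a cofinal sequence a, the k-th set is the closed chain of `a (m k)`, where m grows so
slowly that this chain already contains every `a n` with n ≤ m k and stays smaller than k by at
least m k. This slack is what allows the recursion to continue. -/
theorem exists_isCoherentAt {I : Type u} [LinearOrder I] {α : I} (hc : (Set.Iio α).Countable)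
    {G : I → ℕ → Finset I} (hG : ∀ β < α, IsCoherentAt β G (G β)) :
    ∃ g, IsCoherentAt α G g := by
  classical
  rcases (Set.Iio α).eq_empty_or_nonempty with hem | hne
  · refine ⟨fun _ => ∅, by simp, monotone_const, fun {β} h => ?_, by simp, by simp,
      fun m => ⟨m, by simp⟩⟩
    exact absurd h (Set.eq_empty_iff_forall_notMem.1 hem β)
  obtain ⟨a, hamono, halt, hacof⟩ := exists_monotone_cofinal_Iio hc hne
  let F : ℕ → I → Finset I := fun k β => insert β (G β k)
  have trans : ∀ {k γ β δ}, δ < α → γ ∈ F k β → β ∈ F k δ → γ ∈ F k δ := by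
    intro k γ β δ hδ h1 h2
    rcases Finset.mem_insert.1 h2 with rfl | h2
    · exact h1
    rcases Finset.mem_insert.1 h1 with rfl | h1
    · exact Finset.mem_insert_of_mem h2
    exact Finset.mem_insert_of_mem (((hG δ hδ).mem_iff h2 γ).1 h1).1
  have Fmono : ∀ {k l δ}, δ < α → k ≤ l → F k δ ⊆ F l δ := fun hδ hkl =>
    Finset.insert_subset_insert _ ((hG _ hδ).mono hkl)
  have hex : ∀ {β δ}, δ < α → β ≤ δ → ∃ k, β ∈ F k δ := by
    intro β δ hδ h
    rcases h.eq_or_lt with rfl | h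
    · exact ⟨0, Finset.mem_insert_self _ _⟩
    · obtain ⟨k, hk⟩ := (hG δ hδ).exists_mem h
      exact ⟨k, Finset.mem_insert_of_mem hk⟩
  -- In 1 + n, the 1 pays for adjoining `a n` to its own chain and n is the slack left over.
  obtain ⟨K, hKmono, hK⟩ := Filter.extraction_forall_of_eventually
    (P := fun n k => (∀ l ≥ k, (G (a n) l).card + (1 + n) ≤ l) ∧ a (n - 1) ∈ F k (a n)) (by
      intro n
      obtain ⟨k₀, hk₀⟩ := (hG _ (halt n)).slack (1 + n)
      obtain ⟨k₁, hk₁⟩ := hex (halt n) (hamono (Nat.sub_le n 1))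
      filter_upwards [Filter.eventually_ge_atTop (max k₀ k₁)] with k hk
      exact ⟨fun l hl => hk₀ l ((le_max_left _ _).trans (hk.trans hl)),
        Fmono (halt n) ((le_max_right _ _).trans hk) hk₁⟩)
  have hchain : ∀ {n m k}, n ≤ m → K m ≤ k → a n ∈ F k (a m) := by
    intro n m k hnm
    induction m, hnm using Nat.le_induction with
    | base => exact fun _ => Finset.mem_insert_self _ _
    | succ m hm ih =>
      intro hk
      exact trans (halt _) (ih ((hKmono.monotone (Nat.le_succ m)).trans hk))
        (Fmono (halt _) hk (hK (m + 1)).2)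
  have hm : ∀ k, ∃ m, K 0 ≤ k → K m ≤ k ∧ ∀ n, K n ≤ k → n ≤ m := by
    intro k
    refine ⟨Nat.findGreatest (fun n => K n ≤ k) k, fun h0 =>
      ⟨Nat.findGreatest_spec (P := fun n => K n ≤ k) (Nat.zero_le k) h0, fun n hn =>
        Nat.le_findGreatest ((hKmono.id_le n).trans hn) hn⟩⟩
  choose m hm using hm
  let g : ℕ → Finset I := fun k => if K 0 ≤ k then F k (a (m k)) else ∅
  have hg : ∀ {k β}, β ∈ g k → K 0 ≤ k ∧ β ∈ F k (a (m k)) := by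
    intro k β h
    by_cases h0 : K 0 ≤ k
    · exact ⟨h0, by simpa only [g, if_pos h0] using h⟩
    · simp only [g, if_neg h0, Finset.notMem_empty] at h
  have hg' : ∀ {k n β}, K n ≤ k → β ∈ F k (a n) → β ∈ g k := by
    intro k n β hn h
    have h0 : K 0 ≤ k := (hKmono.monotone (Nat.zero_le n)).trans hn
    simp only [g, if_pos h0]
    exact trans (halt _) h (hchain ((hm k h0).2 n hn) (hm k h0).1)
  have hcard : ∀ {k}, K 0 ≤ k → (g k).card + m k ≤ k := by
    intro k h0
    simp only [g, if_pos h0]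
    have h1 := (hK (m k)).1 k (hm k h0).1
    have h2 := Finset.card_insert_le (a (m k)) (G (a (m k)) k)
    simp only [F]
    omega
  refine ⟨g, fun {k β} h => ?_, fun k l hkl β h => ?_, fun {β} h => ?_, fun {k β} h γ => ?_,
    fun k => ?_, fun M => ⟨K M, fun k hk => ?_⟩⟩
  · rcases Finset.mem_insert.1 (hg h).2 with rfl | h'
    · exact halt _
    · exact ((hG _ (halt _)).lt_of_mem h').trans (halt _)
  · have h' := hg h
    exact hg' ((hm k h'.1).1.trans hkl) (Fmono (halt _) hkl h'.2)
  · obtain ⟨n, hn⟩ := hacof β h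
    obtain ⟨k, hk⟩ := hex (halt n) hn
    exact ⟨max k (K n), hg' (le_max_right _ _) (Fmono (halt n) (le_max_left _ _) hk)⟩
  · obtain ⟨h0, hβ⟩ := hg h
    simp only [g, if_pos h0]
    rcases Finset.mem_insert.1 hβ with rfl | hβ
    · constructor
      · exact fun h => ⟨Finset.mem_insert_of_mem h, (hG _ (halt _)).lt_of_mem h⟩
      · rintro ⟨h1, h2⟩
        exact (Finset.mem_insert.1 h1).resolve_left h2.ne
    · rw [(hG _ (halt _)).mem_iff hβ γ]
      refine ⟨fun h => ⟨Finset.mem_insert_of_mem h.1, h.2⟩, fun h => ⟨?_, h.2⟩⟩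
      refine (Finset.mem_insert.1 h.1).resolve_left ?_
      rintro rfl
      exact lt_asymm h.2 ((hG _ (halt _)).lt_of_mem hβ)
  · by_cases h0 : K 0 ≤ k
    · exact le_of_add_le_left (hcard h0)
    · simp [g, if_neg h0]
  · have h0 : K 0 ≤ k := (hKmono.monotone (Nat.zero_le M)).trans hk
    have := hcard h0
    have := (hm k h0).2 M hk
    omega

theorem nonempty_coherentSystem {I : Type u} [LinearOrder I] [WellFoundedLT I]
    (hI : ∀ α : I, (Set.Iio α).Countable) : Nonempty (CoherentSystem I) := by
  classical
  obtain ⟨G, hG⟩ := exists_of_wellFounded_step (I := I) (T := ℕ → Finset I) IsCoherentAt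
    (fun α G G' t h ht => ⟨ht.lt_of_mem, ht.mono, ht.exists_mem, fun {k β} hβ γ => by
      rw [← h β (ht.lt_of_mem hβ)]; exact ht.mem_iff hβ γ, ht.card_le, ht.slack⟩)
    (fun α G h => exists_isCoherentAt (hI α) h)
  refine ⟨⟨fun k α => insert α (G α k), fun k α => Finset.mem_insert_self _ _,
    fun {k α β} h => ?_, fun {k l} α h => Finset.insert_subset_insert _ ((hG α).mono h),
    fun {α β} h => ?_, fun {k α β} h γ => ?_, fun k α => ?_⟩⟩
  · rcases Finset.mem_insert.1 h with rfl | h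
    exacts [le_rfl, ((hG α).lt_of_mem h).le]
  · rcases h.eq_or_lt with rfl | h
    · exact ⟨0, Finset.mem_insert_self _ _⟩
    · obtain ⟨k, hk⟩ := (hG α).exists_mem h
      exact ⟨k, Finset.mem_insert_of_mem hk⟩
  · rcases Finset.mem_insert.1 h with rfl | h
    · refine ⟨fun h => ⟨h, ?_⟩, fun h => h.1⟩
      rcases Finset.mem_insert.1 h with rfl | h
      exacts [le_rfl, ((hG _).lt_of_mem h).le]
    · simp only [Finset.mem_insert, (hG α).mem_iff h γ]
      constructor
      · rintro (rfl | h')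
        exacts [⟨Or.inr h, le_rfl⟩, ⟨Or.inr h'.1, h'.2.le⟩]
      · rintro ⟨rfl | h1, h2⟩
        · exact absurd ((hG _).lt_of_mem h) (not_lt.2 h2)
        · exact h2.eq_or_lt.imp id fun h2 => ⟨h1, h2⟩
  · exact (Finset.card_insert_le _ _).trans (Nat.add_le_add_right ((hG α).card_le k) 1)

namespace CoherentSystem

variable {I : Type u} [LinearOrder I] (S : CoherentSystem I)

theorem trans {k : ℕ} {α β γ : I} (h₁ : γ ∈ S.F k β) (h₂ : β ∈ S.F k α) : γ ∈ S.F k α :=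
  ((S.mem_iff h₂ γ).1 h₁).1

theorem subset {k : ℕ} {α β : I} (h : β ∈ S.F k α) : S.F k β ⊆ S.F k α :=
  fun _ hγ => S.trans hγ h

theorem mem_of_le {k : ℕ} {α β γ : I} (h₁ : β ∈ S.F k α) (h₂ : γ ∈ S.F k α) (h : γ ≤ β) :
    γ ∈ S.F k β :=
  (S.mem_iff h₁ γ).2 ⟨h₂, h⟩

theorem mem_mono {k l : ℕ} (h : k ≤ l) {α β : I} (hβ : β ∈ S.F k α) : β ∈ S.F l α :=
  S.mono α h hβ

theorem eq_of_mem_zero {α β : I} (h : β ∈ S.F 0 α) : β = α :=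
  Finset.card_le_one.1 (S.card_le 0 α) β h α (S.self_mem 0 α)

theorem countable_Iic {I : Type u} [LinearOrder I] (S : CoherentSystem I) (α : I) : (Set.Iic α).Countable :=
  (Set.countable_iUnion fun k => (S.F k α).countable_toSet).mono fun _ h =>
    Set.mem_iUnion.2 (S.exists_mem h)

theorem exists_gt {I : Type u} [LinearOrder I] (S : CoherentSystem I) {X : Set I} (hX : ¬ X.Countable) (α : I) : ∃ β ∈ X, α < β := by
  by_contra h
  push Not at h
  exact hX ((S.countable_Iic α).mono h)

theorem exists_subset_F {x : Finset I} {α : I} (h : ∀ β ∈ x, β ≤ α) : ∃ k, x ⊆ S.F k α := by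
  classical
  choose! f hf using fun β (hβ : β ∈ x) => S.exists_mem (h β hβ)
  exact ⟨x.sup f, fun β hβ => S.mem_mono (Finset.le_sup hβ) (hf β hβ)⟩

theorem exists_mem_subset_F {x : Finset I} (hx : x.Nonempty) :
    ∃ k, ∃ α ∈ x, x ⊆ S.F k α := by
  obtain ⟨k, hk⟩ := S.exists_subset_F (α := x.max' hx) (fun β hβ => x.le_max' β hβ)
  exact ⟨k, _, x.max'_mem hx, hk⟩

/-- The trace of a coherent system on a subset. -/
noncomputable def restrict (X : Set I) : CoherentSystem X where
  F k α := (S.F k α).preimage Subtype.val Subtype.val_injective.injOn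
  self_mem k α := by simpa using S.self_mem k α
  le_of_mem h := S.le_of_mem (Finset.mem_preimage.1 h)
  mono α h β hβ := by simpa using S.mono α h (Finset.mem_preimage.1 hβ)
  exists_mem h := by
    obtain ⟨k, hk⟩ := S.exists_mem h
    exact ⟨k, by simpa using hk⟩
  mem_iff h γ := by simpa using S.mem_iff (Finset.mem_preimage.1 h) γ
  card_le k α := by
    refine le_trans ?_ (S.card_le k α)
    rw [← Finset.card_map (Function.Embedding.subtype _)]
    exact Finset.card_le_card fun a ha => (by simpa using ha : a ∈ S.F k α ∧ a ∈ X).1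

theorem mem_restrict {X : Set I} {k : ℕ} {α β : X} :
    β ∈ (S.restrict X).F k α ↔ (β : I) ∈ S.F k α :=
  Finset.mem_preimage (hf := Subtype.val_injective.injOn)

end CoherentSystem

/-! ### Similarity of initial segments -/

namespace CoherentSystem

variable {I : Type u} [LinearOrder I] (S : CoherentSystem I)

/-- The height of `α` in the `k`-th tree. -/
def height (k : ℕ) (α : I) : ℕ := (S.F k α).card

theorem height_le_height {k : ℕ} {u v : I} (h : u ∈ S.F k v) : S.height k u ≤ S.height k v :=
  Finset.card_le_card (S.subset h)

theorem eq_of_height_le {k : ℕ} {u v : I} (h : u ∈ S.F k v) (hh : S.height k v ≤ S.height k u) :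
    u = v := by
  have := Finset.eq_of_subset_of_card_le (S.subset h) hh
  exact le_antisymm (S.le_of_mem h) (S.le_of_mem (this ▸ S.self_mem k v))

theorem mem_of_height_le {k : ℕ} {α u v : I} (hu : u ∈ S.F k α) (hv : v ∈ S.F k α)
    (h : S.height k u ≤ S.height k v) : u ∈ S.F k v := by
  rcases le_total u v with huv | huv
  · exact S.mem_of_le hv hu huv
  · have := S.eq_of_height_le (S.mem_of_le hu hv huv) h
    exact this ▸ S.self_mem k v

theorem eq_of_height_eq {k : ℕ} {α u v : I} (hu : u ∈ S.F k α) (hv : v ∈ S.F k α)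
    (h : S.height k u = S.height k v) : u = v :=
  S.eq_of_height_le (S.mem_of_height_le hu hv h.le) h.ge

/-- Height-preserving similarity (in one direction) of the first `k` trees below `α` and `β`
together with the labels `c`. -/
structure Similar (c : ℕ → Finset I → ℕ) (k : ℕ) (α β : I) : Prop where
  exists_mem : ∀ {u}, u ∈ S.F k α → ∃ v ∈ S.F k β, S.height k u = S.height k v
  mem : ∀ {u v u' v'}, u ∈ S.F k α → v ∈ S.F k α → u' ∈ S.F k β → v' ∈ S.F k β →
    S.height k u = S.height k u' → S.height k v = S.height k v' → ∀ {i}, i ≤ k → u ∈ S.F i v →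
      u' ∈ S.F i v'
  label : ∀ {d d' : Finset I}, d ⊆ S.F k α → d' ⊆ S.F k β →
    (∀ u ∈ d, ∃ v ∈ d', S.height k u = S.height k v) →
    (∀ v ∈ d', ∃ u ∈ d, S.height k u = S.height k v) → ∀ {i}, i ≤ k → c i d = c i d'

variable {S} {c : ℕ → Finset I → ℕ}

theorem Similar.height_le {k : ℕ} {α β : I} (h : S.Similar c k α β) :
    S.height k α ≤ S.height k β := by
  obtain ⟨v, hv, h⟩ := h.exists_mem (S.self_mem k α)
  exact h.le.trans (S.height_le_height hv)

theorem Similar.of_mem {k : ℕ} {α β u v : I} (h : S.Similar c k α β) (hu : u ∈ S.F k α)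
    (hv : v ∈ S.F k β) (huv : S.height k u = S.height k v) : S.Similar c k u v where
  exists_mem {x} hx := by
    obtain ⟨y, hy, hxy⟩ := h.exists_mem (S.trans hx hu)
    exact ⟨y, S.mem_of_height_le hy hv (hxy ▸ huv ▸ S.height_le_height hx), hxy⟩
  mem h1 h2 h3 h4 := h.mem (S.trans h1 hu) (S.trans h2 hu) (S.trans h3 hv) (S.trans h4 hv)
  label h1 h2 := h.label (h1.trans (S.subset hu)) (h2.trans (S.subset hv))

theorem Similar.height_le_of_le {k i : ℕ} (hi : i ≤ k) {α β u v : I} (h : S.Similar c k α β)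
    (hu : u ∈ S.F k α) (hv : v ∈ S.F k β) (huv : S.height k u = S.height k v) :
    S.height i u ≤ S.height i v := by
  choose! f hf hfh using fun x (hx : x ∈ S.F k α) => h.exists_mem hx
  have hsub : ∀ {x}, x ∈ S.F i u → x ∈ S.F k α := fun hx => S.trans (S.mem_mono hi hx) hu
  refine Finset.card_le_card_of_injOn f (fun x hx => ?_) fun x hx y hy hxy => ?_
  · exact h.mem (hsub hx) hu (hf x (hsub hx)) hv (hfh x (hsub hx)) huv hi hx
  · exact S.eq_of_height_eq (hsub hx) (hsub hy)
      ((hfh x (hsub hx)).trans ((congrArg _ hxy).trans (hfh y (hsub hy)).symm))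

/-- Height in the i-th tree counts i-predecessors, which similarity at level k preserves. Each
direction gives one inequality between heights, so both are needed. -/
theorem Similar.of_le {k i : ℕ} (hi : i ≤ k) {α β : I} (h : S.Similar c k α β)
    (h' : S.Similar c k β α) : S.Similar c i α β := by
  have hαβ : S.height k α = S.height k β := le_antisymm h.height_le h'.height_le
  have hex : ∀ {u}, u ∈ S.F i α →
      ∃ v ∈ S.F i β, S.height k u = S.height k v ∧ S.height i u = S.height i v := by
    intro u hu
    obtain ⟨v, hv, huv⟩ := h.exists_mem (S.mem_mono hi hu)
    exact ⟨v, h.mem (S.mem_mono hi hu) (S.self_mem k α) hv (S.self_mem k β) huv hαβ hi hu, huv,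
      le_antisymm (h.height_le_of_le hi (S.mem_mono hi hu) hv huv)
        (h'.height_le_of_le hi hv (S.mem_mono hi hu) huv.symm)⟩
  have heq : ∀ {u v}, u ∈ S.F i α → v ∈ S.F i β → S.height i u = S.height i v →
      S.height k u = S.height k v := by
    intro u v hu hv huv
    obtain ⟨w, hw, h1, h2⟩ := hex hu
    rwa [S.eq_of_height_eq hv hw (huv.symm.trans h2)]
  refine ⟨fun hu => ?_, fun {u v u' v'} hu hv hu' hv' h1 h2 j hj => ?_,
    fun {d d'} hd hd' h1 h2 j hj => ?_⟩
  · obtain ⟨v, hv, -, h2⟩ := hex hu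
    exact ⟨v, hv, h2⟩
  · exact h.mem (S.mem_mono hi hu) (S.mem_mono hi hv) (S.mem_mono hi hu') (S.mem_mono hi hv')
      (heq hu hu' h1) (heq hv hv' h2) (hj.trans hi)
  · refine h.label (hd.trans (S.mono α hi)) (hd'.trans (S.mono β hi)) (fun u hu => ?_)
      (fun v hv => ?_) (hj.trans hi)
    · obtain ⟨v, hv, huv⟩ := h1 u hu
      exact ⟨v, hv, heq (hd hu) (hd' hv) huv⟩
    · obtain ⟨u, hu, huv⟩ := h2 v hv
      exact ⟨u, hu, heq (hd hu) (hd' hv) huv⟩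

variable (S c)

/-- The finite data that determine the similarity class of `α` at level `k`. -/
def profile (k : ℕ) (α : I) : Finset (ℕ × ℕ × ℕ) × Finset (ℕ × Finset ℕ × ℕ) :=
  (((Finset.range (k + 1) ×ˢ S.F k α ×ˢ S.F k α).filter fun q => q.2.1 ∈ S.F q.1 q.2.2).image
      fun q => (q.1, S.height k q.2.1, S.height k q.2.2),
    (Finset.range (k + 1) ×ˢ (S.F k α).powerset).image
      fun q => (q.1, q.2.image (S.height k), c q.1 q.2))

theorem mem_profile_fst {k : ℕ} {α : I} {i x y : ℕ} : (i, x, y) ∈ (S.profile c k α).1 ↔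
    i ≤ k ∧ ∃ u ∈ S.F k α, ∃ v ∈ S.F k α, u ∈ S.F i v ∧ S.height k u = x ∧ S.height k v = y := by
  simp only [profile, Finset.mem_image, Finset.mem_filter, Finset.mem_product, Finset.mem_range,
    Prod.exists, Prod.mk.injEq, Nat.lt_succ_iff]
  constructor
  · rintro ⟨j, u, v, ⟨⟨h1, h2, h3⟩, h4⟩, rfl, rfl, rfl⟩
    exact ⟨h1, u, h2, v, h3, h4, rfl, rfl⟩
  · rintro ⟨h1, u, h2, v, h3, h4, rfl, rfl⟩
    exact ⟨i, u, v, ⟨⟨h1, h2, h3⟩, h4⟩, rfl, rfl, rfl⟩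

theorem mem_profile_snd {k : ℕ} {α : I} {i m : ℕ} {A : Finset ℕ} :
    (i, A, m) ∈ (S.profile c k α).2 ↔
      i ≤ k ∧ ∃ d ⊆ S.F k α, d.image (S.height k) = A ∧ c i d = m := by
  simp only [profile, Finset.mem_image, Finset.mem_product, Finset.mem_range,
    Prod.exists, Prod.mk.injEq, Nat.lt_succ_iff, Finset.mem_powerset]
  constructor
  · rintro ⟨j, d, ⟨h1, h2⟩, rfl, rfl, rfl⟩
    exact ⟨h1, d, h2, rfl, rfl⟩
  · rintro ⟨h1, d, h2, rfl, rfl⟩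
    exact ⟨i, d, ⟨h1, h2⟩, rfl, rfl, rfl⟩

variable {S c}

/-- In a chain a point is determined by its height and a subset by its set of heights, so these
numbers recover the correspondence. -/
theorem similar_of_profile_eq {k : ℕ} {α β : I} (h : S.profile c k α = S.profile c k β) :
    S.Similar c k α β where
  exists_mem {u} hu := by
    have := (S.mem_profile_fst c).2 ⟨le_rfl, u, hu, u, hu, S.self_mem k u, rfl, rfl⟩
    rw [h, S.mem_profile_fst c] at this
    obtain ⟨-, v, hv, -, -, -, h1, -⟩ := this
    exact ⟨v, hv, h1.symm⟩
  mem {u v u' v'} hu hv hu' hv' h1 h2 i hi huv := by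
    have := (S.mem_profile_fst c).2 ⟨hi, u, hu, v, hv, huv, rfl, rfl⟩
    rw [h, S.mem_profile_fst c] at this
    obtain ⟨-, a, ha, b, hb, hab, h3, h4⟩ := this
    rwa [← S.eq_of_height_eq ha hu' (h3.trans h1), ← S.eq_of_height_eq hb hv' (h4.trans h2)]
  label {d d'} hd hd' h1 h2 i hi := by
    have := (S.mem_profile_snd c).2 ⟨hi, d, hd, rfl, rfl⟩
    rw [h, S.mem_profile_snd c] at this
    obtain ⟨-, a, ha, h3, h4⟩ := this
    rw [← h4]
    congr 1
    ext v
    constructor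
    · intro hv
      have : S.height k v ∈ d.image (S.height k) := h3 ▸ Finset.mem_image_of_mem _ hv
      obtain ⟨u, hu, huv⟩ := Finset.mem_image.1 this
      obtain ⟨w, hw, huw⟩ := h1 u hu
      rwa [S.eq_of_height_eq (ha hv) (hd' hw) (huv.symm.trans huw)]
    · intro hv
      obtain ⟨u, hu, huv⟩ := h2 v hv
      have : S.height k u ∈ a.image (S.height k) := h3 ▸ Finset.mem_image_of_mem _ hu
      obtain ⟨w, hw, huw⟩ := Finset.mem_image.1 this
      rwa [S.eq_of_height_eq (hd' hv) (ha hw) (huv.symm.trans huw.symm)]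

theorem Similar.profile_subset {k : ℕ} {α β : I} (h : S.Similar c k α β) :
    (S.profile c k α).1 ⊆ (S.profile c k β).1 ∧ (S.profile c k α).2 ⊆ (S.profile c k β).2 := by
  choose! f hf hfh using fun x (hx : x ∈ S.F k α) => h.exists_mem hx
  constructor
  · rintro ⟨i, x, y⟩ hxy
    obtain ⟨hi, u, hu, v, hv, huv, rfl, rfl⟩ := (S.mem_profile_fst c).1 hxy
    exact (S.mem_profile_fst c).2 ⟨hi, f u, hf u hu, f v, hf v hv,
      h.mem hu hv (hf u hu) (hf v hv) (hfh u hu) (hfh v hv) hi huv, (hfh u hu).symm,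
      (hfh v hv).symm⟩
  · rintro ⟨i, A, m⟩ hA
    obtain ⟨hi, d, hd, rfl, rfl⟩ := (S.mem_profile_snd c).1 hA
    have hd' : d.image f ⊆ S.F k β := fun v hv => by
      obtain ⟨u, hu, rfl⟩ := Finset.mem_image.1 hv
      exact hf u (hd hu)
    refine (S.mem_profile_snd c).2 ⟨hi, d.image f, hd', ?_, ?_⟩
    · rw [Finset.image_image]
      exact Finset.image_congr fun u hu => (hfh u (hd hu)).symm
    · refine (h.label hd hd' (fun u hu => ⟨f u, Finset.mem_image_of_mem f hu, hfh u (hd hu)⟩)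
        (fun v hv => ?_) hi).symm
      obtain ⟨u, hu, rfl⟩ := Finset.mem_image.1 hv
      exact ⟨u, hu, hfh u (hd hu)⟩

theorem Similar.profile_eq {k : ℕ} {α β : I} (h : S.Similar c k α β) (h' : S.Similar c k β α) :
    S.profile c k α = S.profile c k β :=
  Prod.ext (h.profile_subset.1.antisymm h'.profile_subset.1)
    (h.profile_subset.2.antisymm h'.profile_subset.2)

end CoherentSystem

/-! ### Types and narrow sets -/

/-- A countable colouring of each tree of a coherent system such that points of the same colour
have isomorphic sets of predecessors. -/
structure TypeSystem {I : Type u} [LinearOrder I] (S : CoherentSystem I) where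
  t : ℕ → I → ℕ
  eq_of_eq : ∀ {k α u v}, u ∈ S.F k α → v ∈ S.F k α → t k u = t k v → u = v
  lift : ∀ {k i α β u}, t k α = t k β → i ≤ k → u ∈ S.F i α → ∃ v ∈ S.F i β, t k v = t k u
  eq_of_le : ∀ {k i α β}, t k α = t k β → i ≤ k → t i α = t i β

namespace TypeSystem

variable {I : Type u} [LinearOrder I] {S : CoherentSystem I}

/-- The label `c i d` depends only on the isomorphism type of `d`. -/
def Respects (T : TypeSystem S) (c : ℕ → Finset I → ℕ) : Prop :=
  ∀ {k α β}, T.t k α = T.t k β → ∀ {d d' : Finset I}, d ⊆ S.F k α → d' ⊆ S.F k β →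
    (∀ u ∈ d, ∃ v ∈ d', T.t k u = T.t k v) → (∀ v ∈ d', ∃ u ∈ d, T.t k u = T.t k v) →
    ∀ {i}, i ≤ k → c i d = c i d'

theorem exists_respects (S : CoherentSystem I) (c : ℕ → Finset I → ℕ) :
    ∃ T : TypeSystem S, T.Respects c := by
  have key : ∀ {k α β}, Encodable.encode (S.profile c k α) = Encodable.encode (S.profile c k β) →
      S.Similar c k α β ∧ S.Similar c k β α := fun h =>
    ⟨CoherentSystem.similar_of_profile_eq (Encodable.encode_injective h),
      CoherentSystem.similar_of_profile_eq (Encodable.encode_injective h).symm⟩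
  have heq : ∀ {k α β}, Encodable.encode (S.profile c k α) = Encodable.encode (S.profile c k β) →
      S.height k α = S.height k β := fun h =>
    le_antisymm (key h).1.height_le (key h).2.height_le
  refine ⟨⟨fun k α => Encodable.encode (S.profile c k α), fun hu hv h => ?_,
    fun {k i α β u} h hi hu => ?_, fun h hi => ?_⟩, ?_⟩
  · exact S.eq_of_height_eq hu hv (heq h)
  · obtain ⟨v, hv, huv⟩ := (key h).1.exists_mem (S.mem_mono hi hu)
    refine ⟨v, (key h).1.mem (S.mem_mono hi hu) (S.self_mem k α) hv (S.self_mem k β) huv (heq h)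
      hi hu, congrArg _ (((key h).2.of_mem hv (S.mem_mono hi hu) huv.symm).profile_eq
        ((key h).1.of_mem (S.mem_mono hi hu) hv huv))⟩
  · exact congrArg _ (((key h).1.of_le hi (key h).2).profile_eq ((key h).2.of_le hi (key h).1))
  · intro k α β h d d' hd hd' h1 h2 i hi
    refine (key h).1.label hd hd' (fun u hu => ?_) (fun v hv => ?_) hi
    · obtain ⟨v, hv, huv⟩ := h1 u hu
      exact ⟨v, hv, heq huv⟩
    · obtain ⟨u, hu, huv⟩ := h2 v hv
      exact ⟨u, hu, heq huv⟩

variable (T : TypeSystem S)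

theorem height_le {k : ℕ} {α β : I} (h : T.t k α = T.t k β) : S.height k α ≤ S.height k β := by
  choose! f hf hft using fun u (hu : u ∈ S.F k α) => T.lift h le_rfl hu
  exact Finset.card_le_card_of_injOn f hf fun u hu v hv huv =>
    T.eq_of_eq hu hv ((hft u hu).symm.trans ((congrArg _ huv).trans (hft v hv)))

theorem height_eq {k : ℕ} {α β : I} (h : T.t k α = T.t k β) : S.height k α = S.height k β :=
  le_antisymm (T.height_le h) (T.height_le h.symm)

/-- `u` has the type of a predecessor of `v` in the `k`-th tree. -/
def Below (k : ℕ) (u v : I) : Prop := ∃ w ∈ S.F k v, T.t k w = T.t k u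

variable {T}

theorem Below.of_mem {k : ℕ} {u v : I} (h : u ∈ S.F k v) : T.Below k u v := ⟨u, h, rfl⟩

theorem Below.of_eq {k : ℕ} {u v : I} (h : T.t k u = T.t k v) : T.Below k u v :=
  ⟨v, S.self_mem k v, h.symm⟩

theorem Below.trans {k : ℕ} {u v w : I} (h₁ : T.Below k u v) (h₂ : T.Below k v w) :
    T.Below k u w := by
  obtain ⟨u', hu', h1⟩ := h₁
  obtain ⟨v', hv', h2⟩ := h₂
  obtain ⟨u'', hu'', h3⟩ := T.lift h2.symm le_rfl hu'
  exact ⟨u'', S.trans hu'' hv', h3.trans h1⟩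

theorem Below.eq_of_height_le {k : ℕ} {u v : I} (h : T.Below k u v)
    (hh : S.height k v ≤ S.height k u) : T.t k u = T.t k v := by
  obtain ⟨u', hu', h1⟩ := h
  rw [← h1, S.eq_of_height_le hu' (hh.trans (T.height_eq h1).ge)]

theorem Below.of_le {k l : ℕ} (hkl : k ≤ l) {u v u' v' : I} (hu : T.t l u = T.t l u')
    (hv : T.t l v = T.t l v') (h : T.Below k u v) : T.Below k u' v' := by
  obtain ⟨w, hw, h1⟩ := h
  obtain ⟨w', hw', h2⟩ := T.lift hv hkl hw
  exact ⟨w', hw', (T.eq_of_le h2 hkl).trans (h1.trans (T.eq_of_le hu hkl))⟩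

/-- Any `n + 1` points of `X` include two whose types are comparable, in each tree. -/
def NarrowOn (T : TypeSystem S) (n : ℕ) (X : Set I) : Prop :=
  ∀ k, ∀ W : Finset I, (W : Set I) ⊆ X → W.card = n + 1 →
    ∃ u ∈ W, ∃ v ∈ W, u ≠ v ∧ T.Below k u v

theorem NarrowOn.mono {n : ℕ} {X Y : Set I} (h : T.NarrowOn n Y) (hXY : X ⊆ Y) :
    T.NarrowOn n X :=
  fun k W hW => h k W (hW.trans hXY)

theorem NarrowOn.exists_finset {n : ℕ} {X : Set I} (h : T.NarrowOn n X) {k : ℕ} {V : Set I}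
    (hV : V ⊆ X) (hinc : ∀ u ∈ V, ∀ v ∈ V, T.Below k u v → T.t k u = T.t k v) :
    ∃ A : Finset ℕ, (A : Set ℕ) = T.t k '' V ∧ A.card ≤ n := by
  classical
  have hlarge : ∀ B : Finset ℕ, (B : Set ℕ) ⊆ T.t k '' V → B.card ≠ n + 1 := by
    intro B hB hcard
    have : Nonempty I := by
      obtain ⟨b, hb⟩ := Finset.card_pos.1 (show 0 < B.card by omega)
      exact ⟨(hB hb).choose⟩
    choose! g hg hgt using fun b (hb : b ∈ B) => hB hb
    obtain ⟨u, hu, v, hv, hne, huv⟩ := h k (B.image g) (fun u hu => by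
      obtain ⟨b, hb, rfl⟩ := Finset.mem_image.1 (Finset.mem_coe.1 hu)
      exact hV (hg b hb)) (by
      rw [Finset.card_image_of_injOn, hcard]
      exact fun a ha b hb hab => (hgt a ha).symm.trans ((congrArg _ hab).trans (hgt b hb)))
    obtain ⟨a, ha, rfl⟩ := Finset.mem_image.1 hu
    obtain ⟨b, hb, rfl⟩ := Finset.mem_image.1 hv
    have := hinc _ (hg a ha) _ (hg b hb) huv
    rw [hgt a ha, hgt b hb] at this
    exact hne (congrArg g this)
  have hfin : (T.t k '' V).Finite := by
    by_contra hinf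
    obtain ⟨B, hB, hc⟩ := Set.Infinite.exists_subset_card_eq hinf (n + 1)
    exact hlarge B hB hc
  refine ⟨hfin.toFinset, by simp, ?_⟩
  by_contra hcard
  obtain ⟨B, hB, hc⟩ := Finset.exists_subset_card_eq (not_le.1 hcard)
  exact hlarge B (fun b hb => by simpa using hB hb) hc

/-- Comparable types of equal height coincide, so narrowness leaves at most n types at each of the
finitely many heights. -/
theorem NarrowOn.finite {n : ℕ} {X : Set I} (h : T.NarrowOn n X) (k : ℕ) :
    (T.t k '' X).Finite := by
  have hfin : ∀ j, (T.t k '' {u ∈ X | S.height k u = j}).Finite := by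
    intro j
    obtain ⟨A, hA, -⟩ := h.exists_finset (k := k) (V := {u ∈ X | S.height k u = j})
      (fun u hu => hu.1) fun u hu v hv huv => huv.eq_of_height_le (hv.2.trans hu.2.symm).le
    exact hA ▸ A.finite_toSet
  refine ((Set.finite_Iic (k + 1)).biUnion fun j _ => hfin j).subset ?_
  rintro _ ⟨u, hu, rfl⟩
  exact Set.mem_biUnion (S.card_le k u) ⟨u, ⟨hu, rfl⟩, rfl⟩

theorem NarrowOn.exists_maximal {n : ℕ} {X : Set I} (h : T.NarrowOn n X) (k : ℕ) :
    ∃ V : Finset I, (V : Set I) ⊆ X ∧ V.card ≤ n ∧ ∀ u ∈ X, ∃ v ∈ V, T.Below k u v := by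
  classical
  cases isEmpty_or_nonempty I
  · exact ⟨∅, by simp, by simp, fun u => isEmptyElim u⟩
  let M : Set I := {u ∈ X | ∀ v ∈ X, T.Below k u v → T.t k u = T.t k v}
  obtain ⟨A, hA, hcard⟩ := h.exists_finset (k := k) (V := M) (fun u hu => hu.1)
    fun u hu v hv huv => hu.2 v hv.1 huv
  choose! g hg hgt using fun a (ha : a ∈ A) => hA.le (Finset.mem_coe.2 ha)
  refine ⟨A.image g, fun u hu => ?_, Finset.card_image_le.trans hcard, fun u hu => ?_⟩
  · obtain ⟨a, ha, rfl⟩ := Finset.mem_image.1 (Finset.mem_coe.1 hu)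
    exact (hg a ha).1
  -- Heights are at most k + 1, so minimising k + 1 minus the height finds a highest v above u.
  · have hne : {j | ∃ v ∈ X, T.Below k u v ∧ k + 1 - S.height k v = j}.Nonempty :=
      ⟨_, u, hu, Below.of_eq rfl, rfl⟩
    obtain ⟨v, hv, huv, hvj⟩ := Nat.sInf_mem hne
    have hvM : v ∈ M := by
      refine ⟨hv, fun w hw hvw => hvw.eq_of_height_le ?_⟩
      have h1 := Nat.sInf_le (show k + 1 - S.height k w ∈
        {j | ∃ v ∈ X, T.Below k u v ∧ k + 1 - S.height k v = j} from ⟨w, hw, huv.trans hvw, rfl⟩)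
      have h2 : S.height k w ≤ k + 1 := S.card_le k w
      have h3 : S.height k v ≤ k + 1 := S.card_le k v
      omega
    have hvA : T.t k v ∈ A := Finset.mem_coe.1 (hA.ge ⟨v, hvM, rfl⟩)
    exact ⟨g (T.t k v), Finset.mem_image_of_mem g hvA,
      huv.trans (Below.of_eq (hgt _ hvA).symm)⟩

/-- A class records a tree l in which x is a chain, and the l-types in x. For k ≥ l, two of n + 1
points lie in one of the n chains. For k < l, all points can be moved into one fixed member without
changing their l-types. -/
theorem isLinkedComplex_narrow (T : TypeSystem S) {n : ℕ} (hn : 2 ≤ n) :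
    IsLinkedComplex n fun x : Finset I => T.NarrowOn n x := by
  classical
  refine IsLinkedComplex.of_rel (C := ℕ × Finset ℕ) ?_ ?_ ?_
    (fun x p => (∃ w, x ⊆ S.F p.1 w) ∧ x.image (T.t p.1) = p.2) ?_ ?_
  · intro k W hW hc
    have := Finset.card_le_card (Finset.coe_subset.1 hW)
    rw [Finset.card_empty] at this
    omega
  · intro a k W hW hc
    have := Finset.card_le_card (Finset.coe_subset.1 hW)
    rw [Finset.card_singleton] at this
    omega
  · exact fun h hxy => h.mono (Finset.coe_subset.2 hxy)
  · intro x _ hx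
    obtain ⟨l, w, -, hl⟩ := S.exists_mem_subset_F hx
    exact ⟨(l, x.image (T.t l)), ⟨w, hl⟩, rfl⟩
  · rintro ⟨l, A⟩ x hx hxn hR z - hz k W hW hc
    have : Nonempty (Fin n) := ⟨⟨0, by omega⟩⟩
    choose! e he using hz
    rcases le_or_gt l k with hkl | hkl
    · obtain ⟨u, hu, v, hv, hne, huv⟩ := Finset.exists_ne_map_eq_of_card_lt_of_maps_to
        (s := W) (t := Finset.univ) (f := e) (by simp [hc]) (fun _ _ => Finset.mem_univ _)
      obtain ⟨w, hw⟩ := (hR (e u)).1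
      have hu' := S.mem_mono hkl (hw (he u (hW hu)))
      have hv' := S.mem_mono hkl (hw (huv ▸ he v (hW hv)))
      rcases le_total u v with h | h
      · exact ⟨u, hu, v, hv, hne, Below.of_mem (S.mem_of_le hv' hu' h)⟩
      · exact ⟨v, hv, u, hu, hne.symm, Below.of_mem (S.mem_of_le hu' hv' h)⟩
    · let e₀ : Fin n := ⟨0, by omega⟩
      have hlift : ∀ u ∈ W, ∃ v ∈ x e₀, T.t l v = T.t l u := by
        intro u hu
        have : T.t l u ∈ (x e₀).image (T.t l) := by
          rw [(hR e₀).2, ← (hR (e u)).2]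
          exact Finset.mem_image_of_mem _ (he u (hW hu))
        simpa using this
      choose! f hf hft using hlift
      by_cases hinj : Set.InjOn f W
      · obtain ⟨a, ha, b, hb, hne, hab⟩ := hx e₀ k (W.image f) (fun u hu => by
          obtain ⟨v, hv, rfl⟩ := Finset.mem_image.1 (Finset.mem_coe.1 hu)
          exact hf v hv) (by rw [Finset.card_image_of_injOn hinj, hc])
        obtain ⟨u, hu, rfl⟩ := Finset.mem_image.1 ha
        obtain ⟨v, hv, rfl⟩ := Finset.mem_image.1 hb
        exact ⟨u, hu, v, hv, fun h => hne (congrArg f h),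
          hab.of_le hkl.le (hft u hu) (hft v hv)⟩
      · simp only [Set.InjOn] at hinj
        push Not at hinj
        obtain ⟨u, hu, v, hv, huv, hne⟩ := hinj
        refine ⟨u, hu, v, hv, hne, Below.of_eq (T.eq_of_le ?_ hkl.le)⟩
        rw [← hft u hu, huv, hft v hv]

end TypeSystem

theorem mk_eq_aleph_one_of_not_countable {I : Type u} (hI : #I = ℵ₁) {Z : Set I}
    (hZ : ¬ Z.Countable) : #Z = ℵ₁ := by
  refine le_antisymm (hI ▸ Cardinal.mk_set_le Z) ?_
  rw [← Cardinal.succ_aleph0, Order.succ_le_iff]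
  by_contra h
  exact hZ (Cardinal.mk_le_aleph0_iff.1 (not_lt.1 h))

theorem IsLinkedComplex.comap {n : ℕ} {I J : Type u} {Φ : Finset I → Prop}
    (h : IsLinkedComplex n Φ) (f : J ↪ I) : IsLinkedComplex n fun x : Finset J => Φ (x.map f) := by
  obtain ⟨c, hc⟩ := h.exists_class
  refine ⟨by simpa using h.empty, fun a => by simpa using h.singleton (f a),
    fun h' hxy => h.mono h' (Finset.map_subset_map.2 hxy), fun x => c (x.map f),
    fun x hx hxc z hz => hc _ hx hxc _ fun u hu => ?_⟩
  obtain ⟨v, hv, rfl⟩ := Finset.mem_map.1 hu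
  obtain ⟨e, he⟩ := hz v hv
  exact ⟨e, Finset.mem_map_of_mem f he⟩

theorem IsLinkedComplex.exists_uncountable_subset {n : ℕ} (H : KnasterOmegaOne.{u} n)
    {I : Type u} (hI : #I = ℵ₁) {Φ : Finset I → Prop} (hΦ : IsLinkedComplex n Φ) {Z : Set I}
    (hZ : ¬ Z.Countable) :
    ∃ Y ⊆ Z, ¬ Y.Countable ∧ ∀ W : Finset I, (W : Set I) ⊆ Y → W.card ≤ n + 1 → Φ W := by
  classical
  obtain ⟨Y, hY, hYΦ⟩ := (hΦ.comap (Function.Embedding.subtype (· ∈ Z))).exists_uncountable H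
    (mk_eq_aleph_one_of_not_countable hI hZ)
  refine ⟨Subtype.val '' Y, fun _ ⟨a, _, h⟩ => h ▸ a.2, fun h => hY
    (Set.countable_of_injective_of_countable_image Subtype.val_injective.injOn h), fun W hW hc => ?_⟩
  obtain ⟨W', rfl⟩ : ∃ W' : Finset Z, W'.map (Function.Embedding.subtype (· ∈ Z)) = W := by
    refine ⟨W.subtype (· ∈ Z), Finset.subtype_map_of_mem fun a ha => ?_⟩
    obtain ⟨b, _, rfl⟩ := hW ha
    exact b.2
  refine hYΦ W' (fun a ha => ?_) (by simpa using hc)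
  obtain ⟨b, hb, hab⟩ := hW (Finset.mem_coe.2 (Finset.mem_map_of_mem _ ha))
  exact Subtype.ext hab ▸ hb

theorem TypeSystem.exists_narrowOn {n : ℕ} (hn : 2 ≤ n) (H : KnasterOmegaOne.{u} n) {I : Type u}
    [LinearOrder I] {S : CoherentSystem I} (T : TypeSystem S) (hI : #I = ℵ₁) {Z : Set I}
    (hZ : ¬ Z.Countable) : ∃ X ⊆ Z, ¬ X.Countable ∧ T.NarrowOn n X := by
  obtain ⟨X, hXZ, hX, h⟩ := (T.isLinkedComplex_narrow hn).exists_uncountable_subset H hI hZ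
  exact ⟨X, hXZ, hX, fun k W hW hc => h W hW hc.le k W le_rfl hc⟩

theorem TypeSystem.exists_label {I : Type u} [LinearOrder I] (S : CoherentSystem I)
    (ℓ : ℕ → I → ℕ) : ∃ T : TypeSystem S, ∀ {k α β}, T.t k α = T.t k β → ℓ k α = ℓ k β := by
  obtain ⟨T, hT⟩ := TypeSystem.exists_respects S fun k d => d.sup (ℓ k)
  refine ⟨T, fun {k α β} h => ?_⟩
  simpa using hT h (d := {α}) (d' := {β}) (by simpa using S.self_mem k α)
    (by simpa using S.self_mem k β) (by simpa using h) (by simpa using h) le_rfl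

theorem not_countable_univ_of_mk {I : Type u} (hI : #I = ℵ₁) : ¬ (Set.univ : Set I).Countable := by
  rw [Set.countable_univ_iff, ← Cardinal.mk_le_aleph0_iff, hI, not_le]
  exact Cardinal.aleph0_lt_aleph_one

/-! ### Bounding and choosing along the trees -/

section

variable {n : ℕ} {I : Type u} [LinearOrder I]

/-- Label α by the maximum of φ over its k-chain. On a narrow uncountable X there are finitely many
k-types, so labels are bounded there, and each ξ eventually lies in the chains of some α ∈ X. -/
theorem exists_eventually_le (hn : 2 ≤ n) (H : KnasterOmegaOne.{u} n) (S : CoherentSystem I)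
    (hI : #I = ℵ₁) (φ : I → ℕ → ℕ) :
    ∃ h : ℕ → ℕ, ∀ ξ, ∀ᶠ k in Filter.atTop, φ ξ k ≤ h k := by
  let ℓ : ℕ → I → ℕ := fun k α => (S.F k α).sup fun ξ => φ ξ k
  obtain ⟨T, hT⟩ := TypeSystem.exists_label S ℓ
  obtain ⟨X, -, hX, hnar⟩ := T.exists_narrowOn hn H hI (not_countable_univ_of_mk hI)
  have hbdd : ∀ k, ∃ b, ∀ α ∈ X, ℓ k α ≤ b := by
    intro k
    have hfin : (ℓ k '' X).Finite := by
      rcases X.eq_empty_or_nonempty with rfl | ⟨x₀, hx₀⟩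
      · simp
      have : Nonempty I := ⟨x₀⟩
      refine ((hnar.finite k).image fun a => ℓ k (Function.invFunOn (T.t k) X a)).subset ?_
      rintro _ ⟨α, hα, rfl⟩
      exact ⟨_, ⟨α, hα, rfl⟩, hT (Function.invFunOn_eq ⟨α, hα, rfl⟩)⟩
    obtain ⟨b, hb⟩ := hfin.bddAbove
    exact ⟨b, fun α hα => hb ⟨α, hα, rfl⟩⟩
  choose h hh using hbdd
  refine ⟨h, fun ξ => ?_⟩
  obtain ⟨α, hα, hξ⟩ := S.exists_gt hX ξ
  obtain ⟨k₀, hk₀⟩ := S.exists_mem hξ.le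
  filter_upwards [Filter.eventually_ge_atTop k₀] with k hk
  exact (Finset.le_sup (f := fun ξ => φ ξ k) (S.mem_mono hk hk₀)).trans (hh k α hα)

/-- Every γ ∈ X has the type of a predecessor w of one of at most n points v. The minimum of `b v k`
lies in `b w k` and is at most `h k`; the type remembers `b w k` up to `h k`, so it lies in `b γ k`
too. -/
theorem exists_small_transversal (hn : 2 ≤ n) (H : KnasterOmegaOne.{u} n) (S : CoherentSystem I)
    (hI : #I = ℵ₁) (b : I → ℕ → Set ℕ) (hne : ∀ ξ k, (b ξ k).Nonempty)
    (hb : ∀ {k α γ}, γ ∈ S.F k α → b α k ⊆ b γ k) :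
    ∃ X : Set I, ¬ X.Countable ∧ ∃ A : ℕ → Finset ℕ, (∀ k, (A k).card ≤ n) ∧
      ∀ᶠ k in Filter.atTop, ∀ γ ∈ X, ∃ s ∈ A k, s ∈ b γ k := by
  classical
  obtain ⟨h, hh⟩ := exists_eventually_le hn H S hI fun ξ k => sInf (b ξ k)
  obtain ⟨k₀, hZ⟩ : ∃ k₀, ¬ {ξ | ∀ k ≥ k₀, sInf (b ξ k) ≤ h k}.Countable := by
    by_contra hcon
    push Not at hcon
    refine not_countable_univ_of_mk hI ((Set.countable_iUnion hcon).mono fun ξ _ => ?_)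
    exact Set.mem_iUnion.2 (Filter.eventually_atTop.1 (hh ξ))
  obtain ⟨T, hT⟩ := TypeSystem.exists_label S fun k α =>
    Encodable.encode ((Finset.range (h k + 1)).filter (· ∈ b α k))
  obtain ⟨X, hXZ, hX, hnar⟩ := T.exists_narrowOn hn H hI hZ
  choose V hVX hVc hV using hnar.exists_maximal
  refine ⟨X, hX, fun k => (V k).image fun v => sInf (b v k),
    fun k => Finset.card_image_le.trans (hVc k), ?_⟩
  filter_upwards [Filter.eventually_ge_atTop k₀] with k hk γ hγ
  obtain ⟨v, hv, w, hw, hwγ⟩ := hV k γ hγ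
  refine ⟨_, Finset.mem_image_of_mem _ hv, ?_⟩
  have h1 : sInf (b v k) ∈ b w k := hb hw (Nat.sInf_mem (hne v k))
  have h2 : sInf (b v k) ≤ h k := hXZ (hVX k hv) k hk
  have h3 := Encodable.encode_injective (hT hwγ)
  have h4 : sInf (b v k) ∈ (Finset.range (h k + 1)).filter (· ∈ b w k) :=
    Finset.mem_filter.2 ⟨Finset.mem_range.2 (Nat.lt_succ_of_le h2), h1⟩
  rw [h3] at h4
  exact (Finset.mem_filter.1 h4).2

/-- Among γ ∈ X take the least trace size on `A k` that is attained for infinitely many k, say by γ₀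
along e. Traces shrink along the trees, so those of any later α ∈ X eventually equal those of γ₀,
and the least element of the latter serves all ξ. -/
theorem exists_eventually_mem (hn : 2 ≤ n) (H : KnasterOmegaOne.{u} n) (S : CoherentSystem I)
    (hI : #I = ℵ₁) (b : I → ℕ → Set ℕ) (hne : ∀ ξ k, (b ξ k).Nonempty)
    (hb : ∀ {k α γ}, γ ∈ S.F k α → b α k ⊆ b γ k) :
    ∃ e : ℕ → ℕ, StrictMono e ∧ ∃ f : ℕ → ℕ, ∀ ξ, ∀ᶠ k in Filter.atTop, f k ∈ b ξ (e k) := by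
  classical
  obtain ⟨X, hX, A, hAc, hA⟩ := exists_small_transversal hn H S hI b hne hb
  let N : I → ℕ → Finset ℕ := fun γ k => (A k).filter (· ∈ b γ k)
  have hex : ∃ m, ∃ γ ∈ X, ∃ᶠ k in Filter.atTop, (N γ k).card ≤ m := by
    obtain ⟨γ, hγ⟩ : X.Nonempty := Set.nonempty_iff_ne_empty.2 fun h => hX (by simp [h])
    exact ⟨n, γ, hγ, (Filter.Eventually.of_forall fun k =>
      (Finset.card_filter_le _ _).trans (hAc k)).frequently⟩
  obtain ⟨γ₀, hγ₀, hfreq⟩ := Nat.find_spec hex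
  have hmin : ∀ γ ∈ X, ∀ᶠ k in Filter.atTop, Nat.find hex ≤ (N γ k).card := by
    intro γ hγ
    by_contra hcon
    rw [Filter.not_eventually] at hcon
    have hpos : 0 < Nat.find hex := by
      obtain ⟨k, hk⟩ := hcon.exists
      omega
    refine Nat.find_min hex (Nat.sub_lt hpos one_pos) ⟨γ, hγ, hcon.mono fun k hk => ?_⟩
    omega
  obtain ⟨e, he, hek⟩ := Filter.extraction_of_frequently_atTop hfreq
  refine ⟨e, he, fun k => sInf (N γ₀ (e k)), fun ξ => ?_⟩
  obtain ⟨α, hα, hlt⟩ := S.exists_gt hX (max ξ γ₀)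
  obtain ⟨k₁, hk₁⟩ := S.exists_mem ((le_max_left ξ γ₀).trans hlt.le)
  obtain ⟨k₂, hk₂⟩ := S.exists_mem ((le_max_right ξ γ₀).trans hlt.le)
  filter_upwards [he.tendsto_atTop.eventually (hmin α hα), he.tendsto_atTop.eventually hA,
    he.tendsto_atTop.eventually (Filter.eventually_ge_atTop k₁),
    he.tendsto_atTop.eventually (Filter.eventually_ge_atTop k₂)] with k h1 h2 h3 h4
  have hsub : N α (e k) ⊆ N γ₀ (e k) := fun s hs => by
    rw [Finset.mem_filter] at hs ⊢
    exact ⟨hs.1, hb (S.mem_mono h4 hk₂) hs.2⟩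
  have heq := Finset.eq_of_subset_of_card_le hsub ((hek k).trans h1)
  have hmem : sInf (N γ₀ (e k) : Set ℕ) ∈ (N γ₀ (e k) : Set ℕ) := by
    obtain ⟨s, hs, hsb⟩ := h2 γ₀ hγ₀
    exact Nat.sInf_mem ⟨s, Finset.mem_coe.2 (Finset.mem_filter.2 ⟨hs, hsb⟩)⟩
  rw [← heq, Finset.mem_coe, Finset.mem_filter] at hmem
  simpa only [heq] using hb (S.mem_mono h3 hk₁) hmem.2

end

theorem exists_nat_code {J A : Type*} (q : J → A) (hq : (Set.range q).Countable) :
    ∃ c : J → ℕ, ∀ a b, c a = c b ↔ q a = q b := by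
  have := hq.to_subtype
  obtain ⟨f, hf⟩ := Countable.exists_injective_nat (Set.range q)
  refine ⟨fun a => f ⟨q a, a, rfl⟩, fun a b => ⟨fun h => congrArg Subtype.val (hf h), fun h => ?_⟩⟩
  simp only [h]

/-! ### Amalgamating types -/

namespace TypeSystem

variable {I : Type u} [LinearOrder I] {S : CoherentSystem I}

/-- Points of the same `k`-th type have the same types of successors in all earlier trees. -/
def Amalgamating (T : TypeSystem S) : Prop :=
  ∀ {j k u v g}, j < k → T.t k u = T.t k v → u ∈ S.F j g → ∃ g', v ∈ S.F j g' ∧ T.t j g' = T.t j g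

section Refinement

variable (T : TypeSystem S) (X : Set I)

/-- The data recorded by one step of the refinement of types. -/
def successorData (k : ℕ) (s : X → ℕ) (u : X) : ℕ × ℕ × Set ℕ :=
  (T.t (k + 1) u, s u, s '' {g : X | (u : I) ∈ S.F k g})

/-- The data of all predecessors recorded by one step of the refinement of types. -/
def predecessorData (k : ℕ) (s : X → ℕ) (α : X) : ℕ × Set (ℕ × ℕ × Set ℕ) :=
  (T.t (k + 1) α, T.successorData X k s '' {u : X | (u : I) ∈ S.F (k + 1) α})

variable {X}

theorem finite_range_predecessorData (hfin : ∀ k, (T.t k '' X).Finite) (k : ℕ) {s : X → ℕ}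
    (hs : (Set.range s).Finite) : (Set.range (T.predecessorData X k s)).Finite := by
  have h : ((T.t (k + 1) '' X) ×ˢ (Set.range s) ×ˢ (𝒫 Set.range s)).Finite :=
    (hfin _).prod (hs.prod hs.powerset)
  refine ((hfin (k + 1)).prod h.powerset).subset ?_
  rintro _ ⟨α, rfl⟩
  refine ⟨⟨α, α.2, rfl⟩, ?_⟩
  rintro _ ⟨u, -, rfl⟩
  exact ⟨⟨u, u.2, rfl⟩, ⟨u, rfl⟩, by rintro _ ⟨g, -, rfl⟩; exact ⟨g, rfl⟩⟩

/-- Finiteness of the range is carried through the recursion: the recorded sets of earlier types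
then take finitely many values and can again be coded by numbers. -/
theorem exists_refinement_seq (hfin : ∀ k, (T.t k '' X).Finite) :
    ∃ s : ℕ → X → ℕ, (∀ α β, s 0 α = s 0 β ↔ T.t 0 α = T.t 0 β) ∧
      ∀ k α β, s (k + 1) α = s (k + 1) β ↔
        T.predecessorData X k (s k) α = T.predecessorData X k (s k) β := by
  classical
  let A := {s : X → ℕ // (Set.range s).Finite}
  have step : ∀ k (s : A), ∃ s' : A, ∀ α β, s'.1 α = s'.1 β ↔
      T.predecessorData X k s.1 α = T.predecessorData X k s.1 β := by
    intro k s
    have hf := T.finite_range_predecessorData hfin k s.2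
    obtain ⟨c, hc⟩ := exists_nat_code _ hf.countable
    refine ⟨⟨c, ?_⟩, hc⟩
    cases isEmpty_or_nonempty X
    · exact Set.finite_range c
    refine (hf.image fun a => c (Function.invFun (T.predecessorData X k s.1) a)).subset ?_
    rintro _ ⟨α, rfl⟩
    exact ⟨_, ⟨α, rfl⟩, (hc _ _).2 (Function.invFun_eq ⟨α, rfl⟩)⟩
  choose f hf using step
  let s : ℕ → A := fun k => Nat.rec ⟨fun α => T.t 0 α, (hfin 0).subset (by
    rintro _ ⟨α, rfl⟩; exact ⟨α, α.2, rfl⟩)⟩ f k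
  exact ⟨fun k => (s k).1, fun _ _ => Iff.rfl, fun k => hf k (s k)⟩

theorem exists_refinement (hfin : ∀ k, (T.t k '' X).Finite) :
    ∃ T' : TypeSystem (S.restrict X), T'.Amalgamating ∧
      ∀ {k} {α β : X}, T'.t k α = T'.t k β → T.t k α = T.t k β := by
  obtain ⟨s, hs0, hs⟩ := T.exists_refinement_seq hfin
  have hT : ∀ {k} {α β : X}, s k α = s k β → T.t k α = T.t k β := by
    intro k α β h
    cases k with
    | zero => exact (hs0 α β).1 h
    | succ k => exact congrArg Prod.fst ((hs k α β).1 h)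
  have hpred : ∀ {k} {α β u : X}, s (k + 1) α = s (k + 1) β → (u : I) ∈ S.F (k + 1) α →
      ∃ v : X, (v : I) ∈ S.F (k + 1) β ∧ T.successorData X k (s k) v =
        T.successorData X k (s k) u := by
    intro k α β u h hu
    have h2 := congrArg Prod.snd ((hs k α β).1 h)
    obtain ⟨v, hv, hvu⟩ := h2.le ⟨u, hu, rfl⟩
    exact ⟨v, hv, hvu⟩
  -- Among the predecessors of β, the one matching α must be β itself, because it has the same
  -- original type.
  have hself : ∀ {k} {α β : X}, s (k + 1) α = s (k + 1) β →
      T.successorData X k (s k) α = T.successorData X k (s k) β := by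
    intro k α β h
    obtain ⟨v, hv, hvα⟩ := hpred h (S.self_mem (k + 1) α)
    have h1 : T.t (k + 1) v = T.t (k + 1) α := congrArg Prod.fst hvα
    rw [← hvα, Subtype.ext (T.eq_of_eq hv (S.self_mem (k + 1) β) (h1.trans (hT h)))]
  have hdown : ∀ {k i} {α β : X}, s k α = s k β → i ≤ k → s i α = s i β := by
    intro k i α β h hi
    induction k, hi using Nat.le_induction with
    | base => exact h
    | succ k _ ih => exact ih (congrArg (fun p => p.2.1) (hself h))
  have hsub : ∀ {k} {α β u v : X}, s (k + 1) α = s (k + 1) β → (u : I) ∈ S.F (k + 1) α →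
      (v : I) ∈ S.F (k + 1) β → T.t (k + 1) u = T.t (k + 1) v →
      T.successorData X k (s k) '' {w : X | (w : I) ∈ S.F (k + 1) u} ⊆
        T.successorData X k (s k) '' {w : X | (w : I) ∈ S.F (k + 1) v} := by
    rintro k α β u v h hu hv huv _ ⟨w, hw, rfl⟩
    obtain ⟨w', hw', hww'⟩ := hpred h (S.trans hw hu)
    refine ⟨w', show (w' : I) ∈ S.F (k + 1) v from ?_, hww'⟩
    obtain ⟨y, hy, hyw⟩ := T.lift huv le_rfl hw
    have h1 : T.t (k + 1) w' = T.t (k + 1) w := congrArg Prod.fst hww'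
    exact T.eq_of_eq (S.trans hy hv) hw' (hyw.trans h1.symm) ▸ hy
  have hlift : ∀ {k} {α β u : X}, s k α = s k β → (u : I) ∈ S.F k α →
      ∃ v : X, (v : I) ∈ S.F k β ∧ s k v = s k u := by
    intro k α β u h hu
    cases k with
    | zero =>
      refine ⟨β, S.self_mem 0 β, ?_⟩
      rw [← h, Subtype.ext (S.eq_of_mem_zero hu)]
    | succ k =>
      obtain ⟨v, hv, hvu⟩ := hpred h hu
      have h1 : T.t (k + 1) v = T.t (k + 1) u := congrArg Prod.fst hvu
      exact ⟨v, hv, (hs k v u).2 (Prod.ext h1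
        ((hsub h.symm hv hu h1).antisymm (hsub h hu hv h1.symm)))⟩
  refine ⟨⟨s, fun {k α u v} hu hv h => ?_, fun {k i α β u} h hi hu => ?_, hdown⟩, ?_, hT⟩
  · exact Subtype.ext (T.eq_of_eq (S.mem_restrict.1 hu) (S.mem_restrict.1 hv) (hT h))
  · have hu' := S.mem_restrict.1 hu
    obtain ⟨v, hv, hvu⟩ := hlift h (S.mem_mono hi hu')
    refine ⟨v, S.mem_restrict.2 ?_, hvu⟩
    obtain ⟨y, hy, hyu⟩ := T.lift (hT h) hi hu'
    exact T.eq_of_eq (S.mem_mono hi hy) hv (hyu.trans (hT hvu).symm) ▸ hy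
  · intro j k u v g hjk h hu
    have h2 := congrArg (fun p => p.2.2) (hself (hdown h (Nat.succ_le_of_lt hjk)))
    obtain ⟨g', hg', hgg'⟩ := h2.le ⟨g, S.mem_restrict.1 hu, rfl⟩
    exact ⟨g', S.mem_restrict.2 hg', hgg'⟩

end Refinement

/-! ### Generated sets and homogeneity -/

/-- The finite sets generated from the sets with at most one element by taking unions of `n`
copies, of the same type, of a generated set. -/
inductive Generated (T : TypeSystem S) (n : ℕ) : Finset I → Prop
  | small {z : Finset I} : z.card ≤ 1 → Generated T n z
  | step {j : ℕ} {α : I} {x : Finset I} {g : Fin n → I} {z : Finset I} : Generated T n x →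
    x ⊆ S.F j α → (∀ e, T.t j (g e) = T.t j α) →
    (∀ u ∈ z, ∃ e, u ∈ S.F j (g e) ∧ ∃ v ∈ x, T.t j v = T.t j u) →
    (∀ w ∈ z, ¬ z ⊆ S.F j w) → Generated T n z

variable {T : TypeSystem S} {n : ℕ}

/-- Let j' be the tree of the last generating step. If j ≤ j', or if V is a chain in tree j', the
types of V already occur in x. Otherwise the n blocks are moved one at a time by amalgamation. -/
theorem Generated.transfer (hT : T.Amalgamating) {z : Finset I} (hz : T.Generated n z)
    {V : Finset I} {j : ℕ} {α : I} (hV : V ⊆ S.F j α)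
    (h : ∀ v ∈ V, ∃ u ∈ z, T.t j u = T.t j v) : T.Generated n V := by
  classical
  induction hz generalizing V j α with
  | @small z hz =>
    refine .small (Finset.card_le_one.2 fun a ha b hb => ?_)
    obtain ⟨u, hu, hua⟩ := h a ha
    obtain ⟨v, hv, hvb⟩ := h b hb
    rw [Finset.card_le_one.1 hz u hu v hv] at hua
    exact T.eq_of_eq (hV ha) (hV hb) (hua.symm.trans hvb)
  | @step j' α₀ x g z hx hxα hg hz hside ih =>
    rcases le_or_gt j j' with hj | hj
    · refine ih hV fun v hv => ?_
      obtain ⟨u, hu, huv⟩ := h v hv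
      obtain ⟨-, -, w, hw, hwu⟩ := hz u hu
      exact ⟨w, hw, (T.eq_of_le hwu hj).trans huv⟩
    by_cases hchain : ∃ w ∈ V, V ⊆ S.F j' w
    · obtain ⟨w, -, hw⟩ := hchain
      refine ih hw fun v hv => ?_
      obtain ⟨u, hu, huv⟩ := h v hv
      obtain ⟨-, -, w', hw', hwu⟩ := hz u hu
      exact ⟨w', hw', hwu.trans (T.eq_of_le huv hj.le)⟩
    push Not at hchain
    have hblock : ∀ e, ∃ g', T.t j' g' = T.t j' α₀ ∧
        ∀ v ∈ V, (∃ u ∈ z, u ∈ S.F j' (g e) ∧ T.t j u = T.t j v) → v ∈ S.F j' g' := by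
      intro e
      let B := V.filter fun v => ∃ u ∈ z, u ∈ S.F j' (g e) ∧ T.t j u = T.t j v
      rcases B.eq_empty_or_nonempty with hB | hB
      · refine ⟨g e, hg e, fun v hv hu => ?_⟩
        exact absurd (Finset.mem_filter.2 ⟨hv, hu⟩) (Finset.eq_empty_iff_forall_notMem.1 hB v)
      have : Nonempty I := ⟨α⟩
      choose! p hpz hpg hpt using fun v (hv : v ∈ B) => (Finset.mem_filter.1 hv).2
      -- Amalgamation is applied only to the point whose image is highest; equality of types puts
      -- the rest of the block below that point.
      obtain ⟨m, hm, hmax⟩ := B.exists_max_image p hB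
      obtain ⟨g', hg', hgt⟩ := hT hj (hpt m hm) (hpg m hm)
      refine ⟨g', hgt.trans (hg e), fun v hv hu => ?_⟩
      have hvB : v ∈ B := Finset.mem_filter.2 ⟨hv, hu⟩
      obtain ⟨y, hy, hyv⟩ := T.lift (hpt m hm) hj.le
        (S.mem_of_le (hpg m hm) (hpg v hvB) (hmax v hvB))
      have hmV := hV (Finset.mem_filter.1 hm).1
      rw [T.eq_of_eq (S.trans (S.mem_mono hj.le hy) hmV) (hV hv) (hyv.trans (hpt v hvB))] at hy
      exact S.trans hy hg'
    choose g' hg' hmem using hblock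
    refine .step hx hxα hg' (fun v hv => ?_) hchain
    obtain ⟨u, hu, huv⟩ := h v hv
    obtain ⟨e, hue, w, hw, hwu⟩ := hz u hu
    exact ⟨e, hmem e v hv ⟨u, hu, hue, huv⟩, w, hw, hwu.trans (T.eq_of_le huv hj.le)⟩

theorem Generated.mono (hT : T.Amalgamating) {x z : Finset I} (hz : T.Generated n z)
    (h : x ⊆ z) : T.Generated n x := by
  rcases x.eq_empty_or_nonempty with rfl | hx
  · exact .small (by simp)
  obtain ⟨k, w, -, hw⟩ := S.exists_mem_subset_F hx
  exact hz.transfer hT hw fun v hv => ⟨v, h hv, rfl⟩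

/-- A class records a tree l, the l-type of a point above x, and the l-types in x. A union of n
members of a class is a generating step, unless it is a chain in tree l; then its types all occur in
one member and `transfer` applies. -/
theorem isLinkedComplex_generated (hT : T.Amalgamating) (hn : 2 ≤ n) :
    IsLinkedComplex n fun x : Finset I => T.Generated n x := by
  classical
  refine IsLinkedComplex.of_rel (C := ℕ × ℕ × Finset ℕ) (.small (by simp))
    (fun a => .small (by simp)) (fun h hxy => h.mono hT hxy)
    (fun x p => ∃ w, x ⊆ S.F p.1 w ∧ T.t p.1 w = p.2.1 ∧ x.image (T.t p.1) = p.2.2) ?_ ?_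
  · intro x _ hx
    obtain ⟨l, w, -, hl⟩ := S.exists_mem_subset_F hx
    exact ⟨(l, T.t l w, x.image (T.t l)), w, hl, rfl, rfl⟩
  · rintro ⟨l, τ, A⟩ x hx - hR z - hz
    choose g hg hgτ hA using hR
    let e₀ : Fin n := ⟨0, by omega⟩
    have hlift : ∀ {u e}, u ∈ x e → ∃ v ∈ x e₀, T.t l v = T.t l u := by
      intro u e hu
      have : T.t l u ∈ (x e₀).image (T.t l) := by
        rw [hA e₀, ← hA e]
        exact Finset.mem_image_of_mem _ hu
      simpa using this
    by_cases hchain : ∃ w ∈ z, z ⊆ S.F l w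
    · obtain ⟨w, -, hw⟩ := hchain
      refine (hx e₀).transfer hT hw fun v hv => ?_
      obtain ⟨e, he⟩ := hz v hv
      exact hlift he
    · push Not at hchain
      refine .step (hx e₀) (hg e₀) (fun e => (hgτ e).trans (hgτ e₀).symm) (fun u hu => ?_) hchain
      obtain ⟨e, he⟩ := hz u hu
      exact ⟨e, hg e he, hlift he⟩

/-- By `hinv` the n copies in a generating step lie in Φ and in one class, so their union is in Φ.
-/
theorem Generated.face {Φ : Finset I → Prop} (hΦ : IsLinkedComplex n Φ) {c : Finset I → ℕ}
    (hc : ∀ x : Fin n → Finset I, (∀ e, Φ (x e)) → (∀ e e', c (x e) = c (x e')) →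
      ∀ z : Finset I, (∀ u ∈ z, ∃ e, u ∈ x e) → Φ z)
    (hinv : ∀ {k α β}, T.t k α = T.t k β → ∀ {d d' : Finset I}, d ⊆ S.F k α → d' ⊆ S.F k β →
      (∀ u ∈ d, ∃ v ∈ d', T.t k u = T.t k v) → (∀ v ∈ d', ∃ u ∈ d, T.t k u = T.t k v) →
      Φ d → Φ d' ∧ c d' = c d)
    {z : Finset I} (hz : T.Generated n z) : Φ z := by
  classical
  induction hz with
  | @small z hz =>
    rcases z.eq_empty_or_nonempty with rfl | ⟨a, ha⟩
    · exact hΦ.empty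
    · rw [Finset.eq_singleton_iff_unique_mem.2
        ⟨ha, fun b hb => Finset.card_le_one.1 hz b hb a ha⟩]
      exact hΦ.singleton a
  | @step j α x g z hx hxα hg hz hside ih =>
    have hcopy : ∀ e, Φ ((S.F j (g e)).filter fun v => ∃ u ∈ x, T.t j u = T.t j v) ∧
        c ((S.F j (g e)).filter fun v => ∃ u ∈ x, T.t j u = T.t j v) = c x := by
      intro e
      refine hinv (hg e).symm hxα (Finset.filter_subset _ _) (fun u hu => ?_)
        (fun v hv => (Finset.mem_filter.1 hv).2) ih
      obtain ⟨v, hv, hvu⟩ := T.lift (hg e).symm le_rfl (hxα hu)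
      exact ⟨v, Finset.mem_filter.2 ⟨hv, u, hu, hvu.symm⟩, hvu.symm⟩
    refine hc _ (fun e => (hcopy e).1) (fun e e' => (hcopy e).2.trans (hcopy e').2.symm) z
      fun u hu => ?_
    obtain ⟨e, he, v, hv, hvu⟩ := hz u hu
    exact ⟨e, Finset.mem_filter.2 ⟨he, v, hv, hvu⟩⟩

/-- A well-chosen subset W of size n + 1 is itself generated by some step, and the tree and copies
of that step also serve the whole of a. What remains is a set that is a chain in a lower tree. -/
theorem generated_of_card_le (hT : T.Amalgamating) (hn : 2 ≤ n) (K : ℕ) (a : Finset I)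
    (hchain : ∃ w ∈ a, a ⊆ S.F K w)
    (ha : ∀ W ⊆ a, W.card ≤ n + 1 → T.Generated n W) : T.Generated n a := by
  classical
  induction K using Nat.strong_induction_on generalizing a with
  | _ K ih =>
  rcases le_or_gt a.card (n + 1) with hcard | hcard
  · exact ha a le_rfl hcard
  obtain ⟨w, hwa, hw⟩ := hchain
  -- The maximal points of a in the k-th tree: all of a for k = 0, at most w for k = K.
  let M : ℕ → Finset I := fun k => a.filter fun u => ∀ v ∈ a, u ∈ S.F k v → v = u
  have hM0 : M 0 = a := Finset.filter_true_of_mem fun u _ v _ h => (S.eq_of_mem_zero h).symm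
  have hMK : (M K).card ≤ n := by
    have : M K ⊆ {w} := fun u hu => by
      have hu := Finset.mem_filter.1 hu
      exact Finset.mem_singleton.2 (hu.2 w hwa (hw hu.1)).symm
    have := Finset.card_le_card this
    rw [Finset.card_singleton] at this
    omega
  have hex : ∃ k, (M k).card ≤ n := ⟨K, hMK⟩
  obtain ⟨k, hk⟩ : ∃ k, Nat.find hex = k + 1 := Nat.exists_eq_succ_of_ne_zero fun h0 => by
    have := Nat.find_spec hex
    rw [h0, hM0] at this
    omega
  have hk1 : (M (k + 1)).card ≤ n := hk ▸ Nat.find_spec hex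
  have hk2 : n < (M k).card := not_le.1 (Nat.find_min hex (by omega))
  have hMsub : M (k + 1) ⊆ M k := fun u hu => by
    rw [Finset.mem_filter] at hu ⊢
    exact ⟨hu.1, fun v hv huv => hu.2 v hv (S.mem_mono (Nat.le_succ k) huv)⟩
  -- Since k + 1 is the first level with at most n maximal points, W can be pairwise incomparable in
  -- tree k and yet contain all maximal points of tree k + 1.
  obtain ⟨W, hMW, hWM, hWc⟩ := Finset.exists_subsuperset_card_eq hMsub
    (hk1.trans (Nat.le_succ n)) (Nat.succ_le_of_lt hk2)
  have hWa : W ⊆ a := hWM.trans (Finset.filter_subset _ _)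
  obtain hW | @⟨j, α, x, g, _, hx, hxα, hg, hW, hside⟩ := ha W hWa hWc.le
  · omega
  have : Nonempty (Fin n) := ⟨⟨0, by omega⟩⟩
  -- Two of the n + 1 points fall under the same copy and are comparable in tree j.
  have hkj : k < j := by
    by_contra hjk
    choose! e he using hW
    obtain ⟨u, hu, v, hv, hne, huv⟩ := Finset.exists_ne_map_eq_of_card_lt_of_maps_to
      (s := W) (t := Finset.univ) (f := e) (by simp [hWc]) (fun _ _ => Finset.mem_univ _)
    have hu' := (he u hu).1
    have hv' := huv ▸ (he v hv).1
    rcases le_total u v with h | h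
    · exact hne ((Finset.mem_filter.1 (hWM hu)).2 v (hWa hv)
        (S.mem_mono (not_lt.1 hjk) (S.mem_of_le hv' hu' h))).symm
    · exact hne ((Finset.mem_filter.1 (hWM hv)).2 u (hWa hu)
        (S.mem_mono (not_lt.1 hjk) (S.mem_of_le hu' hv' h)))
  -- The top point w belongs to W, and the side condition forbids W to lie below it in tree j.
  have hjK : j < K := by
    by_contra hKj
    have hwM : w ∈ M (k + 1) := Finset.mem_filter.2 ⟨hwa, fun v hv hwv =>
      le_antisymm (S.le_of_mem (hw hv)) (S.le_of_mem hwv)⟩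
    exact hside w (hMW hwM) ((hWa.trans hw).trans (S.mono w (not_lt.1 hKj)))
  by_cases hchain : ∃ w ∈ a, a ⊆ S.F j w
  · exact ih j hjK a hchain ha
  push Not at hchain
  have hcover : ∀ u ∈ a, ∃ e, u ∈ S.F j (g e) := by
    intro u hu
    obtain ⟨m, hm, hmax⟩ := (a.filter fun v => u ∈ S.F (k + 1) v).exists_max_image id
      ⟨u, Finset.mem_filter.2 ⟨hu, S.self_mem _ u⟩⟩
    rw [Finset.mem_filter] at hm
    have hmM : m ∈ M (k + 1) := Finset.mem_filter.2 ⟨hm.1, fun v hv hmv =>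
      le_antisymm (hmax v (Finset.mem_filter.2 ⟨hv, S.trans hm.2 hmv⟩)) (S.le_of_mem hmv)⟩
    obtain ⟨e, he, -⟩ := hW m (hMW hmM)
    exact ⟨e, S.trans (S.mem_mono (Nat.succ_le_of_lt hkj) hm.2) he⟩
  -- The copy below α of all j-types of a. Its small subsets are generated, being transferred from
  -- small subsets of a.
  let b := (S.F j α).filter fun v => ∃ u ∈ a, T.t j u = T.t j v
  have hb : ∀ u ∈ a, ∃ v ∈ b, T.t j v = T.t j u := by
    intro u hu
    obtain ⟨e, he⟩ := hcover u hu
    obtain ⟨v, hv, hvu⟩ := T.lift (hg e) le_rfl he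
    exact ⟨v, Finset.mem_filter.2 ⟨hv, u, hu, hvu.symm⟩, hvu⟩
  have hbα : b ⊆ S.F j α := Finset.filter_subset _ _
  have hbne : b.Nonempty := (hb w hwa).imp fun _ h => h.1
  have hbG : T.Generated n b := by
    refine ih j hjK b ⟨b.max' hbne, b.max'_mem hbne, fun v hv =>
      S.mem_of_le (hbα (b.max'_mem hbne)) (hbα hv) (b.le_max' v hv)⟩ fun V hV hVc => ?_
    have : Nonempty I := ⟨w⟩
    choose! p hp hpt using fun v (hv : v ∈ b) => (Finset.mem_filter.1 hv).2
    refine (ha (V.image p) (fun u hu => ?_) (Finset.card_image_le.trans hVc)).transfer hT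
      (hV.trans hbα) fun v hv => ⟨p v, Finset.mem_image_of_mem p hv, hpt v (hV hv)⟩
    obtain ⟨v, hv, rfl⟩ := Finset.mem_image.1 hu
    exact hp v (hV hv)
  exact .step hbG hbα hg (fun u hu => (hcover u hu).imp fun e he => ⟨he, hb u hu⟩) hchain

end TypeSystem

theorem IsLinkedComplex.exists_homogeneous {n : ℕ} (hn : 2 ≤ n) (H : KnasterOmegaOne.{u} n)
    {I : Type u} [LinearOrder I] (S : CoherentSystem I) (hI : #I = ℵ₁) {Φ : Finset I → Prop}
    (hΦ : IsLinkedComplex n Φ) :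
    ∃ Y : Set I, ¬ Y.Countable ∧ ∀ W : Finset I, (W : Set I) ⊆ Y → Φ W := by
  classical
  obtain ⟨c, hc⟩ := hΦ.exists_class
  -- The label 0 marks nonmembers of Φ, so types decide both membership and class.
  obtain ⟨T, hT⟩ := TypeSystem.exists_respects S fun _ d => if Φ d then c d + 1 else 0
  obtain ⟨X, -, hX, hnar⟩ := T.exists_narrowOn hn H hI (not_countable_univ_of_mk hI)
  obtain ⟨T', hT', hTT'⟩ := T.exists_refinement hnar.finite
  obtain ⟨Y, hY, hYG⟩ := (TypeSystem.isLinkedComplex_generated hT' hn).exists_uncountable H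
    (mk_eq_aleph_one_of_not_countable hI hX)
  let ι : X ↪ I := Function.Embedding.subtype (· ∈ X)
  refine ⟨ι '' Y, fun h => hY (Set.countable_of_injective_of_countable_image
    ι.injective.injOn h), fun W hW => ?_⟩
  obtain ⟨V, hV, rfl⟩ := Finset.subset_set_image_iff.1 hW
  rw [← Finset.map_eq_image]
  have hgen : T'.Generated n V := by
    rcases V.eq_empty_or_nonempty with rfl | hne
    · exact .small (by simp)
    obtain ⟨k, hk⟩ := (S.restrict X).exists_mem_subset_F hne
    exact TypeSystem.generated_of_card_le hT' hn k V hk fun U hU hUc =>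
      hYG U ((Finset.coe_subset.2 hU).trans hV) hUc
  refine hgen.face (hΦ.comap ι) (c := fun d => c (d.map ι)) (fun x hx hxc z hz =>
    hc _ hx hxc _ fun u hu => ?_) fun {k α β} h d d' hd hd' h1 h2 hΦd => ?_
  · obtain ⟨v, hv, rfl⟩ := Finset.mem_map.1 hu
    obtain ⟨e, he⟩ := hz v hv
    exact ⟨e, Finset.mem_map_of_mem ι he⟩
  · have := hT (hTT' h) (d := d.map ι) (d' := d'.map ι) (fun u hu => by
        obtain ⟨v, hv, rfl⟩ := Finset.mem_map.1 hu
        exact S.mem_restrict.1 (hd hv)) (fun u hu => by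
        obtain ⟨v, hv, rfl⟩ := Finset.mem_map.1 hu
        exact S.mem_restrict.1 (hd' hv)) (fun u hu => by
        obtain ⟨v, hv, rfl⟩ := Finset.mem_map.1 hu
        obtain ⟨w, hw, hvw⟩ := h1 v hv
        exact ⟨w, Finset.mem_map_of_mem ι hw, hTT' hvw⟩) (fun u hu => by
        obtain ⟨v, hv, rfl⟩ := Finset.mem_map.1 hu
        obtain ⟨w, hw, hvw⟩ := h2 v hv
        exact ⟨w, Finset.mem_map_of_mem ι hw, hTT' hvw⟩) (le_refl k)
    beta_reduce at this
    by_cases hd'' : Φ (d'.map ι)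
    · rw [if_pos hΦd, if_pos hd''] at this
      exact ⟨hd'', by omega⟩
    · rw [if_pos hΦd, if_neg hd''] at this
      omega

/-! ### From linked to centered -/

/-- A subset of a poset is centered if all its finite subsets have a common lower bound. -/
def IsCentered {P : Type u} [PartialOrder P] (X : Set P) : Prop :=
  ∀ s : Finset P, (s : Set P) ⊆ X → ∃ q : P, ∀ p ∈ s, q ≤ p

theorem IsLinked.exists_le_of_card_le {P : Type u} [PartialOrder P] {n : ℕ} {X : Set P}
    (h : IsLinked n X) (hX : X.Infinite) {s : Finset P} (hs : (s : Set P) ⊆ X)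
    (hc : s.card ≤ n) : ∃ q : P, ∀ p ∈ s, q ≤ p := by
  classical
  obtain ⟨V, hV, hVc⟩ := hX.exists_subset_card_eq n
  obtain ⟨s', h1, h2, h3⟩ := Finset.exists_subsuperset_card_eq
    (Finset.subset_union_left : s ⊆ s ∪ V) hc
    (hVc ▸ Finset.card_le_card Finset.subset_union_right)
  obtain ⟨q, hq⟩ := h s' (fun a ha => (Finset.mem_union.1 (h2 ha)).elim (fun h => hs h)
    fun h => hV h) h3
  exact ⟨q, fun p hp => hq p (h1 hp)⟩

/-- Repetitions are harmless in an infinite linked class, where smaller sets can be enlarged. A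
finite class may have fewer than n elements, so it is split into singletons. -/
theorem SigmaLinked.exists_coloring {P : Type u} [PartialOrder P] {n : ℕ} (hn : n ≠ 0)
    (h : SigmaLinked n P) : ∃ c : P → ℕ, ∀ x : Fin n → P, (∀ e e', c (x e) = c (x e')) →
      ∃ q, ∀ e, q ≤ x e := by
  classical
  obtain ⟨A, hA, hU⟩ := h
  choose m hm using fun p => Set.mem_iUnion.1 (hU.ge (Set.mem_univ p))
  have hf : ∀ i, ∃ f : P → ℕ, ¬ {p | m p = i}.Infinite → Set.InjOn f {p | m p = i} := by
    intro i
    by_cases hi : {p | m p = i}.Infinite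
    · exact ⟨0, fun h => absurd hi h⟩
    · obtain ⟨f, hf⟩ := Set.countable_iff_exists_injOn.1 (Set.not_infinite.1 hi).countable
      exact ⟨f, fun _ => hf⟩
  choose f hf using hf
  refine ⟨fun p => Nat.pair (m p) (if {q | m q = m p}.Infinite then 0 else f (m p) p),
    fun x hx => ?_⟩
  let e₀ : Fin n := ⟨0, Nat.pos_of_ne_zero hn⟩
  have hmx : ∀ e, m (x e) = m (x e₀) := fun e => (Nat.pair_eq_pair.1 (hx e e₀)).1
  by_cases hi : {q | m q = m (x e₀)}.Infinite
  · obtain ⟨q, hq⟩ := (hA (m (x e₀))).exists_le_of_card_le (hi.mono fun q hq =>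
        (show m q = m (x e₀) from hq) ▸ hm q)
      (s := Finset.univ.image x) (fun p hp => by
        obtain ⟨e, -, rfl⟩ := Finset.mem_image.1 (Finset.mem_coe.1 hp)
        exact hmx e ▸ hm (x e)) (Finset.card_image_le.trans (by simp))
    exact ⟨q, fun e => hq _ (Finset.mem_image_of_mem x (Finset.mem_univ e))⟩
  · refine ⟨x e₀, fun e => le_of_eq ?_⟩
    have := (Nat.pair_eq_pair.1 (hx e₀ e)).2
    rw [hmx e, if_neg hi, if_neg hi] at this
    exact hf _ hi rfl (hmx e) this

/-- The predecessors, in the `k`-th tree, of members of `x` that have height `h` and are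
mapped to the class `m` by `c`. -/
def levelSet {I : Type u} [LinearOrder I] (S : CoherentSystem I) (c : I → ℕ) (k h m : ℕ)
    (x : Set I) : Set I :=
  {ξ | S.height k ξ = h ∧ c ξ = m ∧ ∃ β ∈ x, ξ ∈ S.F k β}

theorem levelSet_mono {I : Type u} [LinearOrder I] {S : CoherentSystem I} {c : I → ℕ} {k h m : ℕ}
    {x y : Set I} (hxy : x ⊆ y) : levelSet S c k h m x ⊆ levelSet S c k h m y :=
  fun _ ⟨h1, h2, β, hβ, h3⟩ => ⟨h1, h2, β, hxy hβ, h3⟩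

theorem levelSet_subsingleton {I : Type u} [LinearOrder I] {S : CoherentSystem I} {c : I → ℕ}
    {k l h m : ℕ} {x : Set I} {w : I} (hx : ∀ β ∈ x, β ∈ S.F l w) (hlk : l ≤ k) :
    (levelSet S c k h m x).Subsingleton := by
  rintro ξ ⟨h1, -, β, hβ, h2⟩ ξ' ⟨h1', -, β', hβ', h2'⟩
  exact S.eq_of_height_eq (S.trans h2 (S.mem_mono hlk (hx β hβ)))
    (S.trans h2' (S.mem_mono hlk (hx β' hβ'))) (h1.trans h1'.symm)

theorem exists_le_of_class {P : Type u} [PartialOrder P] [Nonempty P] {n : ℕ} {c : P → ℕ}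
    (hc : ∀ x : Fin n → P, (∀ e e', c (x e) = c (x e')) → ∃ q, ∀ e, q ≤ x e) {I : Type*}
    {p : I → P} {A : Fin n → Set I}
    (h : ∃ m, ∀ e, (A e).Nonempty → ∃ q, c q = m ∧ ∀ ξ ∈ A e, q ≤ p ξ) :
    ∃ q, ∀ e, ∀ ξ ∈ A e, q ≤ p ξ := by
  classical
  obtain ⟨m, h⟩ := h
  by_cases hne : ∃ e, (A e).Nonempty
  · obtain ⟨e₀, he₀⟩ := hne
    obtain ⟨q₀, hq₀, -⟩ := h e₀ he₀
    have : ∀ e, ∃ q, c q = m ∧ ∀ ξ ∈ A e, q ≤ p ξ := by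
      intro e
      by_cases he : (A e).Nonempty
      · exact h e he
      · exact ⟨q₀, hq₀, fun ξ hξ => absurd ⟨ξ, hξ⟩ he⟩
    choose q hq hqA using this
    obtain ⟨r, hr⟩ := hc q fun e e' => (hq e).trans (hq e').symm
    exact ⟨r, fun e ξ hξ => (hr e).trans (hqA e ξ hξ)⟩
  · exact ⟨Classical.arbitrary P, fun e ξ hξ => absurd ⟨e, ξ, hξ⟩ hne⟩

/-- A class records a tree l in which x is a chain, and the colours of chosen lower bounds for the
levels k < l. There, n lower bounds of one colour have a common lower bound. For k ≥ l, each member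
has at most one point in the level set, of colour m. -/
theorem isLinkedComplex_bounded {P : Type u} [PartialOrder P] [Nonempty P] {n : ℕ} {c : P → ℕ}
    (hc : ∀ x : Fin n → P, (∀ e e', c (x e) = c (x e')) → ∃ q, ∀ e, q ≤ x e) {I : Type u}
    [LinearOrder I] (S : CoherentSystem I) (p : I → P) :
    IsLinkedComplex n fun x : Finset I =>
      ∀ k h m, ∃ q, ∀ ξ ∈ levelSet S (c ∘ p) k h m x, q ≤ p ξ := by
  classical
  have hsub : ∀ {A : Set I}, A.Subsingleton → ∃ q, ∀ ξ ∈ A, q ≤ p ξ := by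
    intro A hA
    rcases A.eq_empty_or_nonempty with rfl | ⟨ξ, hξ⟩
    · exact ⟨Classical.arbitrary P, by simp⟩
    · exact ⟨p ξ, fun ξ' h => (congrArg p (hA hξ h)).le⟩
  refine IsLinkedComplex.of_rel (C := ℕ × Finset ((ℕ × ℕ × ℕ) × ℕ)) (fun k h m => ?_)
    (fun a k h m => ?_) (fun h hxy k i m => ?_)
    (fun x r => (∃ w, x ⊆ S.F r.1 w) ∧
      (∀ i m m', (i, m) ∈ r.2 → (i, m') ∈ r.2 → m = m') ∧
      ∀ k < r.1, ∀ h m, (levelSet S (c ∘ p) k h m x).Nonempty →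
        ∃ q, ((k, h, m), c q) ∈ r.2 ∧ ∀ ξ ∈ levelSet S (c ∘ p) k h m x, q ≤ p ξ) ?_ ?_
  · exact ⟨Classical.arbitrary P, fun ξ hξ => by
      obtain ⟨-, -, β, hβ, -⟩ := hξ
      simp at hβ⟩
  · exact hsub (levelSet_subsingleton (w := a) (l := 0)
      (by simpa using S.self_mem 0 a) (Nat.zero_le k))
  · exact (h k i m).imp fun q hq ξ hξ => hq ξ (levelSet_mono (Finset.coe_subset.2 hxy) hξ)
  · intro x hx hxn
    choose q hq using hx
    obtain ⟨l, w, -, hl⟩ := S.exists_mem_subset_F hxn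
    refine ⟨(l, (Finset.range l).biUnion fun k => (x.biUnion (S.F k)).image fun ξ =>
      ((k, S.height k ξ, c (p ξ)), c (q k (S.height k ξ) (c (p ξ))))), ⟨w, hl⟩, ?_, ?_⟩
    · intro i m m' hm hm'
      simp only [Finset.mem_biUnion, Finset.mem_image, Prod.mk.injEq] at hm hm'
      obtain ⟨k, -, ξ, -, rfl, rfl⟩ := hm
      obtain ⟨k', -, ξ', -, h1, rfl⟩ := hm'
      simp only [Prod.mk.injEq] at h1
      obtain ⟨rfl, h2, h3⟩ := h1
      rw [h2, h3]
    · rintro k hk h m ⟨ξ, rfl, rfl, β, hβ, hξ⟩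
      refine ⟨q k (S.height k ξ) (c (p ξ)), ?_, hq _ _ _⟩
      exact Finset.mem_biUnion.2 ⟨k, Finset.mem_range.2 hk, Finset.mem_image.2
        ⟨ξ, Finset.mem_biUnion.2 ⟨β, hβ, hξ⟩, rfl⟩⟩
  · rintro ⟨l, D⟩ x - - hR z - hz k h m
    have hred : (∃ m', ∀ e, (levelSet S (c ∘ p) k h m (x e)).Nonempty →
        ∃ q, c q = m' ∧ ∀ ξ ∈ levelSet S (c ∘ p) k h m (x e), q ≤ p ξ) →
        ∃ q, ∀ ξ ∈ levelSet S (c ∘ p) k h m z, q ≤ p ξ := by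
      intro hm'
      obtain ⟨q, hq⟩ := exists_le_of_class hc hm'
      refine ⟨q, fun ξ ⟨h1, h2, β, hβ, h3⟩ => ?_⟩
      obtain ⟨e, he⟩ := hz β hβ
      exact hq e ξ ⟨h1, h2, β, he, h3⟩
    apply hred
    rcases le_or_gt l k with hlk | hkl
    · refine ⟨m, fun e ⟨ξ, hξ⟩ => ⟨p ξ, hξ.2.1, fun ξ' hξ' => ?_⟩⟩
      obtain ⟨w, hw⟩ := (hR e).1
      exact (congrArg p (levelSet_subsingleton (fun β hβ => hw hβ) hlk hξ hξ')).le
    · by_cases hne : ∃ e, (levelSet S (c ∘ p) k h m (x e)).Nonempty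
      · obtain ⟨e₀, he₀⟩ := hne
        obtain ⟨q₀, hq₀, -⟩ := (hR e₀).2.2 k hkl h m he₀
        refine ⟨c q₀, fun e he => ?_⟩
        obtain ⟨q, hq, hqb⟩ := (hR e).2.2 k hkl h m he
        exact ⟨q, (hR e).2.1 _ _ _ hq hq₀, hqb⟩
      · exact ⟨0, fun e he => absurd ⟨e, he⟩ hne⟩

/-- Homogeneity of Y makes its level sets centered, and they cover P because Y is cofinal in I. -/
theorem SigmaLinked.exists_isCentered {n : ℕ} (hn : 2 ≤ n) (H : KnasterOmegaOne.{u} n)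
    {I : Type u} [LinearOrder I] (S : CoherentSystem I) (hI : #I = ℵ₁) {P : Type u}
    [PartialOrder P] (hP : SigmaLinked n P) {p : I → P} (hp : Function.Surjective p) :
    ∃ U : ℕ → Set P, (∀ i, IsCentered (U i)) ∧ ⋃ i, U i = Set.univ := by
  classical
  have hIne : Nonempty I := by
    by_contra hcon
    have := not_nonempty_iff.1 hcon
    exact not_countable_univ_of_mk hI Set.countable_univ
  have : Nonempty P := hIne.map p
  obtain ⟨c, hc⟩ := hP.exists_coloring (by omega)
  obtain ⟨Y, hY, hYΦ⟩ := (isLinkedComplex_bounded hc S p).exists_homogeneous hn H S hI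
  refine ⟨fun i => p '' levelSet S (c ∘ p) i.unpair.1 i.unpair.2.unpair.1 i.unpair.2.unpair.2 Y,
    fun i s hs => ?_, ?_⟩
  · obtain ⟨V, hV, rfl⟩ := Finset.subset_set_image_iff.1 hs
    choose! f hfY hf using fun ξ (hξ : ξ ∈ V) => (hV hξ).2.2
    obtain ⟨q, hq⟩ := hYΦ (V.image f) (fun β hβ => by
      obtain ⟨ξ, hξ, rfl⟩ := Finset.mem_image.1 (Finset.mem_coe.1 hβ)
      exact hfY ξ hξ) i.unpair.1 i.unpair.2.unpair.1 i.unpair.2.unpair.2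
    refine ⟨q, fun r hr => ?_⟩
    obtain ⟨ξ, hξ, rfl⟩ := Finset.mem_image.1 hr
    exact hq ξ ⟨(hV hξ).1, (hV hξ).2.1, f ξ, Finset.mem_image_of_mem f hξ, hf ξ hξ⟩
  · refine Set.eq_univ_of_forall fun q => ?_
    obtain ⟨ξ, rfl⟩ := hp q
    obtain ⟨β, hβ, hlt⟩ := S.exists_gt hY ξ
    obtain ⟨k, hk⟩ := S.exists_mem hlt.le
    exact Set.mem_iUnion.2 ⟨Nat.pair k (Nat.pair (S.height k ξ) (c (p ξ))),
      ξ, by simpa [levelSet] using ⟨β, hβ, hk⟩, rfl⟩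

/-! ### Meeting ω₁ dense sets -/

section

variable {n : ℕ} {I : Type u} [LinearOrder I] {P : Type u} [PartialOrder P]

theorem IsDense.exists_le_forall_mem {P : Type u} [PartialOrder P] {ι : Type*} {D : ι → Set P}
    (hD : ∀ ξ, IsDense (D ξ)) (hlow : ∀ ξ, IsLowerSet (D ξ)) (s : Finset ι) (p : P) :
    ∃ q ≤ p, ∀ ξ ∈ s, q ∈ D ξ := by
  classical
  induction s using Finset.induction_on with
  | empty => exact ⟨p, le_rfl, by simp⟩
  | insert ξ s _ ih =>
    obtain ⟨q, hqp, hq⟩ := ih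
    obtain ⟨r, hr, hrq⟩ := hD ξ q
    refine ⟨r, hrq.trans hqp, fun ζ hζ => ?_⟩
    rcases Finset.mem_insert.1 hζ with rfl | hζ
    · exact hr
    · exact hlow ζ hrq (hq ζ hζ)

/-- Finitely many members of `U i` have a common lower bound, which extends into finitely many of
the dense sets; so some class suits every pair coded in `F k α`. `exists_eventually_mem` makes the
choice independent of α. -/
theorem exists_eventually_class (hn : 2 ≤ n) (H : KnasterOmegaOne.{u} n) (S : CoherentSystem I)
    (hI : #I = ℵ₁) {U : ℕ → Set P} (hU : ∀ i, IsCentered (U i)) (hUc : ⋃ i, U i = Set.univ)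
    {ψ : I → P × I} (hψ : Function.Surjective ψ) {D : I → Set P} (hD : ∀ ξ, IsDense (D ξ))
    (hlow : ∀ ξ, IsLowerSet (D ξ)) (i : ℕ) :
    ∃ f : ℕ → ℕ, ∀ p ∈ U i, ∀ ξ, ∀ᶠ k in Filter.atTop, ∃ q ≤ p, q ∈ D ξ ∧ q ∈ U (f k) := by
  classical
  obtain ⟨e, -, f, hf⟩ := exists_eventually_mem hn H S hI
    (fun α k => {j | ∀ β ∈ S.F k α, (ψ β).1 ∈ U i → ∃ q ≤ (ψ β).1, q ∈ D (ψ β).2 ∧ q ∈ U j})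
    (fun α k => by
      obtain ⟨r, hr⟩ := hU i (((S.F k α).image fun β => (ψ β).1).filter (· ∈ U i))
        fun p hp => (Finset.mem_filter.1 (Finset.mem_coe.1 hp)).2
      obtain ⟨q, hqr, hq⟩ := IsDense.exists_le_forall_mem hD hlow
        ((S.F k α).image fun β => (ψ β).2) r
      obtain ⟨j, hj⟩ := Set.mem_iUnion.1 (hUc.ge (Set.mem_univ q))
      exact ⟨j, fun β hβ hβU => ⟨q, hqr.trans (hr _ (Finset.mem_filter.2
        ⟨Finset.mem_image_of_mem (fun β => (ψ β).1) hβ, hβU⟩)),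
        hq _ (Finset.mem_image_of_mem (fun β => (ψ β).2) hβ), hj⟩⟩)
    (fun {k α γ} hγ j hj β hβ => hj β (S.trans hβ hγ))
  refine ⟨f, fun p hp ξ => ?_⟩
  obtain ⟨α, hα⟩ := hψ (p, ξ)
  filter_upwards [hf α] with k hk
  have := hk α (S.self_mem _ α)
  rw [hα] at this
  exact this hp

/-- Finite sequences index a tree of classes, and each ξ follows a branch with points of its own. A
branch growing fast enough makes the points of each ξ eventually decrease and enter `D ξ`. At each
stage the points for all ξ lie in one centered class. -/
theorem exists_centered_meeting (hn : 2 ≤ n) (H : KnasterOmegaOne.{u} n) (S : CoherentSystem I)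
    (hI : #I = ℵ₁) [Nonempty P] {U : ℕ → Set P} (hU : ∀ i, IsCentered (U i))
    (hUc : ⋃ i, U i = Set.univ) {ψ : I → P × I} (hψ : Function.Surjective ψ) {D : I → Set P}
    (hD : ∀ ξ, IsDense (D ξ)) (hlow : ∀ ξ, IsLowerSet (D ξ)) :
    ∃ G : Set P, IsCentered G ∧ ∀ ξ, (G ∩ D ξ).Nonempty := by
  classical
  choose f hf using exists_eventually_class hn H S hI hU hUc hψ hD hlow
  let p₀ : P := Classical.arbitrary P
  obtain ⟨i₀, hi₀⟩ := Set.mem_iUnion.1 (hUc.ge (Set.mem_univ p₀))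
  let cl : List ℕ → ℕ := fun t => t.rec i₀ fun k _ i => f i k
  let good : I → P → ℕ → P → Prop := fun ξ p j q => q ≤ p ∧ q ∈ D ξ ∧ q ∈ U j
  let next : I → P → ℕ → P := fun ξ p j =>
    if h : ∃ q, good ξ p j q then h.choose
    else if h : (U j).Nonempty then h.choose else p₀
  have hnext : ∀ {ξ p j}, (∃ q, good ξ p j q) → good ξ p j (next ξ p j) := by
    intro ξ p j h
    simp only [next]
    rw [dif_pos h]
    exact h.choose_spec
  have hnextU : ∀ {ξ p j}, (U j).Nonempty → next ξ p j ∈ U j := by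
    intro ξ p j hj
    by_cases h : ∃ q, good ξ p j q
    · exact (hnext h).2.2
    · simp only [next]
      rw [dif_neg h, dif_pos hj]
      exact hj.choose_spec
  let pt : I → List ℕ → P := fun ξ t => t.rec p₀ fun k t p => next ξ p (cl (k :: t))
  have hthr : ∀ ξ t, ∃ b, pt ξ t ∈ U (cl t) → ∀ k ≥ b, ∃ q, good ξ (pt ξ t) (cl (k :: t)) q := by
    intro ξ t
    by_cases h : pt ξ t ∈ U (cl t)
    · obtain ⟨b, hb⟩ := Filter.eventually_atTop.1 (hf (cl t) _ h ξ)
      exact ⟨b, fun _ k hk => hb k hk⟩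
    · exact ⟨0, fun h' => absurd h' h⟩
  choose φ hφ using hthr
  obtain ⟨h, hh⟩ := exists_eventually_le hn H S hI
    fun ξ k => φ ξ (Denumerable.ofNat (List ℕ) k)
  obtain ⟨ξ₀⟩ : Nonempty I := by
    by_contra hcon
    have := not_nonempty_iff.1 hcon
    exact not_countable_univ_of_mk hI Set.countable_univ
  -- The bound h works for each ξ only from some stage on. Including the thresholds of ξ₀ keeps
  -- every class on the branch nonempty, so the default in `next` keeps all points in the class.
  let b : List ℕ → ℕ := fun t => max (h (Encodable.encode t)) (φ ξ₀ t)
  let br : ℕ → List ℕ := fun m => m.rec [] fun _ t => b t :: t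
  have hbr : ∀ m, br (m + 1) = b (br m) :: br m := fun _ => rfl
  have hpt : ∀ ξ m, pt ξ (br (m + 1)) = next ξ (pt ξ (br m)) (cl (br (m + 1))) := fun _ _ => rfl
  have hlen : ∀ m, (br m).length = m := by
    intro m
    induction m with
    | zero => rfl
    | succ m ih => rw [hbr, List.length_cons, ih]
  have htend : Filter.Tendsto (fun m => Encodable.encode (br m)) Filter.atTop Filter.atTop :=
    Function.Injective.nat_tendsto_atTop fun m m' hmm' => by
      rw [← hlen m, ← hlen m', Encodable.encode_injective hmm']
  have hne₀ : ∀ m, pt ξ₀ (br m) ∈ U (cl (br m)) := by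
    intro m
    induction m with
    | zero => exact hi₀
    | succ m ih => exact (hnext (hφ ξ₀ (br m) ih (b (br m)) (le_max_right _ _))).2.2
  have hmem : ∀ ξ m, pt ξ (br m) ∈ U (cl (br m)) := by
    intro ξ m
    cases m with
    | zero => exact hi₀
    | succ m => rw [hpt]; exact hnextU ⟨_, hne₀ (m + 1)⟩
  have hev : ∀ ξ, ∃ m₀, ∀ m ≥ m₀, good ξ (pt ξ (br m)) (cl (br (m + 1))) (pt ξ (br (m + 1))) := by
    intro ξ
    refine Filter.eventually_atTop.1 ?_
    filter_upwards [htend.eventually (hh ξ)] with m hm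
    rw [Denumerable.ofNat_encode] at hm
    exact hnext (hφ ξ (br m) (hmem ξ m) (b (br m)) (hm.trans (le_max_left _ _)))
  choose m₀ hm₀ using hev
  have hanti : ∀ ξ m m', m₀ ξ ≤ m → m ≤ m' → pt ξ (br m') ≤ pt ξ (br m) := by
    intro ξ m m' hm hmm'
    induction m', hmm' using Nat.le_induction with
    | base => exact le_rfl
    | succ m' hm' ih => exact (hm₀ ξ m' (hm.trans hm')).1.trans ih
  refine ⟨{q | ∃ ξ, ∃ m ≥ m₀ ξ, q = pt ξ (br m)}, fun s hs => ?_, fun ξ =>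
    ⟨pt ξ (br (m₀ ξ + 1)), ⟨ξ, _, Nat.le_succ _, rfl⟩, (hm₀ ξ _ le_rfl).2.1⟩⟩
  have : Nonempty I := ⟨ξ₀⟩
  have hs' : ∀ q ∈ s, ∃ ξ, ∃ m, m₀ ξ ≤ m ∧ q = pt ξ (br m) := fun q hq => hs hq
  choose! x m hm hq using hs'
  obtain ⟨r, hr⟩ := hU (cl (br (s.sup m))) (s.image fun q => pt (x q) (br (s.sup m)))
    fun q hq => by
      obtain ⟨q', -, rfl⟩ := Finset.mem_image.1 (Finset.mem_coe.1 hq)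
      exact hmem _ _
  refine ⟨r, fun q hqs => ?_⟩
  refine (hr _ (Finset.mem_image_of_mem (fun q => pt (x q) (br (s.sup m))) hqs)).trans ?_
  have := hanti (x q) (m q) (s.sup m) (hm q hqs) (Finset.le_sup hqs)
  rwa [← hq q hqs] at this

end

/-! ### Filters and reduction to size ω₁ -/

/-- The elements below both `p` and `q` or incompatible with one of them. -/
def decisionSet {P : Type u} [PartialOrder P] (p q : P) : Set P :=
  {r | (r ≤ p ∧ r ≤ q) ∨ (∀ s ≤ r, ¬ s ≤ p) ∨ ∀ s ≤ r, ¬ s ≤ q}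

theorem isDense_decisionSet {P : Type u} [PartialOrder P] (p q : P) :
    IsDense (decisionSet p q) := by
  intro r
  by_cases h : ∃ s ≤ r, s ≤ p
  · obtain ⟨s, hsr, hsp⟩ := h
    by_cases h' : ∃ s' ≤ s, s' ≤ q
    · obtain ⟨s', h1, h2⟩ := h'
      exact ⟨s', Or.inl ⟨h1.trans hsp, h2⟩, h1.trans hsr⟩
    · push Not at h'
      exact ⟨s, Or.inr (Or.inr h'), hsr⟩
  · push Not at h
    exact ⟨r, Or.inr (Or.inl h), le_rfl⟩

theorem isLowerSet_decisionSet {P : Type u} [PartialOrder P] (p q : P) :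
    IsLowerSet (decisionSet p q) := by
  rintro r r' hr (⟨h1, h2⟩ | h | h)
  · exact Or.inl ⟨hr.trans h1, hr.trans h2⟩
  · exact Or.inr (Or.inl fun s hs => h s (hs.trans hr))
  · exact Or.inr (Or.inr fun s hs => h s (hs.trans hr))

theorem exists_pFilter_of_isCentered {P : Type u} [PartialOrder P] [Nonempty P] {G : Set P}
    (hG : IsCentered G) (hdec : ∀ p q, (G ∩ decisionSet p q).Nonempty) :
    ∃ F : Order.PFilter P, ∀ x, x ∈ F ↔ ∃ g ∈ G, g ≤ x := by
  classical
  have hF : Order.IsPFilter {x : P | ∃ g ∈ G, g ≤ x} := by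
    refine Order.IsPFilter.of_def ?_ ?_ ?_
    · obtain ⟨g, hg, -⟩ := hdec (Classical.arbitrary P) (Classical.arbitrary P)
      exact ⟨g, g, hg, le_rfl⟩
    · rintro x ⟨g, hg, hgx⟩ y ⟨g', hg', hgy⟩
      obtain ⟨r, hr, hrd⟩ := hdec g g'
      have hcompat : ∀ {a}, a ∈ G → ¬ ∀ s ≤ r, ¬ s ≤ a := by
        intro a ha hcon
        obtain ⟨s, hs⟩ := hG {r, a} (by simp [Set.insert_subset_iff, hr, ha])
        exact hcon s (hs r (by simp)) (hs a (by simp))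
      rcases hrd with ⟨h1, h2⟩ | h | h
      · exact ⟨r, ⟨r, hr, le_rfl⟩, h1.trans hgx, h2.trans hgy⟩
      · exact absurd h (hcompat hg)
      · exact absurd h (hcompat hg')
    · rintro x y hxy ⟨g, hg, hgx⟩
      exact ⟨g, hg, hgx.trans hxy⟩
  exact ⟨hF.toPFilter, fun x => Iff.rfl⟩

theorem exists_surjective_of_mk_le {A B : Type u} [Nonempty A] (h : #A ≤ #B) :
    ∃ f : B → A, Function.Surjective f := by
  obtain ⟨g⟩ := h
  exact ⟨Function.invFun g, Function.invFun_surjective g.injective⟩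

theorem exists_coherentSystem_aleph_one :
    ∃ (I : Type u) (_ : LinearOrder I), #I = ℵ₁ ∧ Nonempty (CoherentSystem I) := by
  refine ⟨(ℵ₁ : Cardinal.{u}).ord.ToType, inferInstance, Cardinal.mk_ord_toType _, ?_⟩
  refine nonempty_coherentSystem fun α => ?_
  rw [← Cardinal.le_aleph0_iff_set_countable, ← Cardinal.lt_aleph_one_iff]
  exact (Cardinal.mk_Iio_lt α (by simp)).trans_eq (Cardinal.mk_ord_toType _)

theorem SigmaLinked.exists_pFilter_of_mk_le {n : ℕ} (hn : 2 ≤ n) (H : KnasterOmegaOne.{u} n)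
    {P : Type u} [PartialOrder P] [Nonempty P] (hP : SigmaLinked n P) (hPc : #P ≤ ℵ₁)
    {𝒟 : Set (Set P)} (h𝒟 : #𝒟 ≤ ℵ₁) (hD : ∀ D ∈ 𝒟, IsDense D) :
    ∃ G : Order.PFilter P, ∀ D ∈ 𝒟, ((G : Set P) ∩ D).Nonempty := by
  obtain ⟨I, _, hI, ⟨S⟩⟩ := exists_coherentSystem_aleph_one.{u}
  have hIne : Nonempty I := by
    rw [← Cardinal.mk_ne_zero_iff, hI]
    exact (Cardinal.aleph_pos 1).ne'
  have hinf : ℵ₀ ≤ (ℵ₁ : Cardinal.{u}) := Cardinal.aleph0_le_aleph 1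
  obtain ⟨p, hp⟩ := exists_surjective_of_mk_le (hPc.trans hI.ge)
  obtain ⟨ψ, hψ⟩ : ∃ ψ : I → P × I, Function.Surjective ψ := by
    refine exists_surjective_of_mk_le ?_
    rw [Cardinal.mk_prod, Cardinal.lift_id, Cardinal.lift_id, hI]
    exact Cardinal.mul_le_of_le hinf hPc le_rfl
  obtain ⟨χ, hχ⟩ : ∃ χ : I → 𝒟 ⊕ (P × P), Function.Surjective χ := by
    refine exists_surjective_of_mk_le ?_
    rw [Cardinal.mk_sum, Cardinal.mk_prod]
    simp only [Cardinal.lift_id, hI]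
    exact Cardinal.add_le_of_le hinf h𝒟 (Cardinal.mul_le_of_le hinf hPc hPc)
  obtain ⟨U, hU, hUc⟩ := hP.exists_isCentered hn H S hI hp
  -- Downward closures make the given sets lower sets; the decision sets make the centered set
  -- generate a filter.
  let E : 𝒟 ⊕ (P × P) → Set P :=
    Sum.elim (fun D => {q | ∃ r ∈ D.1, q ≤ r}) fun r => decisionSet r.1 r.2
  obtain ⟨G, hG, hGE⟩ := exists_centered_meeting hn H S hI hU hUc hψ (D := E ∘ χ)
    (fun ξ => by
      simp only [Function.comp]
      rcases χ ξ with D | r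
      · intro q
        obtain ⟨r, hr, hrq⟩ := hD D D.2 q
        exact ⟨r, ⟨r, hr, le_rfl⟩, hrq⟩
      · exact isDense_decisionSet _ _)
    (fun ξ => by
      simp only [Function.comp]
      rcases χ ξ with D | r
      · rintro q q' hq ⟨r, hr, hqr⟩
        exact ⟨r, hr, hq.trans hqr⟩
      · exact isLowerSet_decisionSet _ _)
  have hGE' : ∀ a, (G ∩ E a).Nonempty := fun a => by
    obtain ⟨ξ, rfl⟩ := hχ a
    exact hGE ξ
  obtain ⟨F, hF⟩ := exists_pFilter_of_isCentered hG fun p q => hGE' (Sum.inr (p, q))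
  refine ⟨F, fun D hDm => ?_⟩
  obtain ⟨q, hqG, r, hr, hqr⟩ := hGE' (Sum.inl ⟨D, hDm⟩)
  exact ⟨r, (hF r).2 ⟨q, hqG, hqr⟩, hr⟩

theorem exists_closed_subset {P : Type u} (p₀ : P) {ι : Type u} (hι : #ι ≤ ℵ₁) (f : ι → P → P)
    (g : List P → P) : ∃ Q : Set P, #Q ≤ ℵ₁ ∧ p₀ ∈ Q ∧ (∀ i, ∀ p ∈ Q, f i p ∈ Q) ∧
      ∀ l : List P, (∀ p ∈ l, p ∈ Q) → g l ∈ Q := by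
  have hinf : ℵ₀ ≤ (ℵ₁ : Cardinal.{u}) := Cardinal.aleph0_le_aleph 1
  let step : Set P → Set P := fun X =>
    X ∪ ((Set.range fun r : ι × X => f r.1 r.2) ∪
      Set.range fun l : List X => g (l.map Subtype.val))
  let Q : ℕ → Set P := fun k => k.rec {p₀} fun _ => step
  have hQ : ∀ k, Q k ⊆ Q (k + 1) := fun k => Set.subset_union_left
  have hmono : Monotone Q := monotone_nat_of_le_succ hQ
  have hcard : ∀ k, #(↥(Q k)) ≤ ℵ₁ := by
    intro k
    induction k with
    | zero => exact (Cardinal.mk_singleton p₀).trans_le (Cardinal.one_le_aleph0.trans hinf)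
    | succ k ih =>
      refine (Cardinal.mk_union_le _ _).trans (Cardinal.add_le_of_le hinf ih
        ((Cardinal.mk_union_le _ _).trans (Cardinal.add_le_of_le hinf
          (Cardinal.mk_range_le.trans ?_) (Cardinal.mk_range_le.trans ?_))))
      · rw [Cardinal.mk_prod, Cardinal.lift_id, Cardinal.lift_id]
        exact Cardinal.mul_le_of_le hinf hι ih
      · exact (Cardinal.mk_list_le_max _).trans (max_le hinf ih)
  refine ⟨⋃ k, Q k, ?_, Set.mem_iUnion.2 ⟨0, rfl⟩, fun i p hp => ?_, fun l hl => ?_⟩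
  · have hU : (⋃ k, Q k) = ⋃ k : ULift.{u} ℕ, Q k.down := by
      ext p
      simp
    rw [hU]
    refine (Cardinal.mk_iUnion_le _).trans (Cardinal.mul_le_of_le hinf (by simp)
      (ciSup_le' fun k => hcard k.down))
  · obtain ⟨k, hk⟩ := Set.mem_iUnion.1 hp
    exact Set.mem_iUnion.2 ⟨k + 1, Or.inr (Or.inl ⟨(i, ⟨p, hk⟩), rfl⟩)⟩
  · have : ∃ k, ∀ p ∈ l, p ∈ Q k := by
      induction l with
      | nil => exact ⟨0, by simp⟩
      | cons a l ih =>
        obtain ⟨k, hk⟩ := ih fun p hp => hl p (List.mem_cons_of_mem a hp)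
        obtain ⟨k', hk'⟩ := Set.mem_iUnion.1 (hl a List.mem_cons_self)
        refine ⟨max k k', fun p hp => ?_⟩
        rcases List.mem_cons.1 hp with rfl | hp
        · exact hmono (le_max_right k k') hk'
        · exact hmono (le_max_left k k') (hk p hp)
    obtain ⟨k, hk⟩ := this
    refine Set.mem_iUnion.2 ⟨k + 1, Or.inr (Or.inr
      ⟨l.attach.map fun p => ⟨p.1, hk p.1 p.2⟩, ?_⟩)⟩
    simp [List.map_map, Function.comp_def]

/-- Closing a point under witnesses of density and under lower bounds of finite lists gives a
subposet of size at most ω₁ that is still σ-n-linked and has dense traces. Its filter generates the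
required one. -/
theorem KnasterOmegaOne.martinAxiomOmegaOne {n : ℕ} (hn : 2 ≤ n) (H : KnasterOmegaOne.{u} n) :
    MartinAxiomOmegaOne.{u} (SigmaLinked n) := by
  classical
  intro P _ _ hP 𝒟 h𝒟 hD
  obtain ⟨A, hA, hAU⟩ := hP
  choose f hf hfle using fun (D : 𝒟) (p : P) => hD D D.2 p
  have hg : ∀ l : List P, ∃ q, (∃ r, ∀ p ∈ l, r ≤ p) → ∀ p ∈ l, q ≤ p := fun l => by
    by_cases h : ∃ r, ∀ p ∈ l, r ≤ p
    · exact ⟨h.choose, fun _ => h.choose_spec⟩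
    · exact ⟨Classical.arbitrary P, fun h' => absurd h' h⟩
  choose g hg using hg
  obtain ⟨Q, hQ, hp₀, hfQ, hgQ⟩ := exists_closed_subset (Classical.arbitrary P) h𝒟 f g
  have : Nonempty Q := ⟨⟨_, hp₀⟩⟩
  have hQlinked : SigmaLinked n Q := by
    refine ⟨fun m => Subtype.val ⁻¹' A m, fun m s hs hc => ?_, ?_⟩
    · obtain ⟨r, hr⟩ := hA m (s.map (Function.Embedding.subtype (· ∈ Q))) (fun p hp => by
        obtain ⟨q, hq, rfl⟩ := Finset.mem_map.1 (Finset.mem_coe.1 hp)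
        exact hs hq) (by rw [Finset.card_map, hc])
      let l := (s.map (Function.Embedding.subtype (· ∈ Q))).toList
      have hl : ∀ p ∈ l, p ∈ Q := fun p hp => by
        obtain ⟨q, -, rfl⟩ := Finset.mem_map.1 (Finset.mem_toList.1 hp)
        exact q.2
      refine ⟨⟨g l, hgQ l hl⟩, fun p hp => hg l ⟨r, fun q hq => hr q (Finset.mem_toList.1 hq)⟩ p ?_⟩
      exact Finset.mem_toList.2 (Finset.mem_map_of_mem (Function.Embedding.subtype (· ∈ Q)) hp)
    · rw [← Set.preimage_iUnion, hAU, Set.preimage_univ]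
  obtain ⟨G, hG⟩ := hQlinked.exists_pFilter_of_mk_le hn H hQ
    (𝒟 := Set.range fun D : 𝒟 => (Subtype.val ⁻¹' D.1 : Set Q)) (Cardinal.mk_range_le.trans h𝒟) (by
      rintro _ ⟨D, rfl⟩ p
      exact ⟨⟨f D p, hfQ D p p.2⟩, hf D p, hfle D p⟩)
  have hF : Order.IsPFilter {x : P | ∃ q ∈ G, (q : P) ≤ x} := by
    refine Order.IsPFilter.of_def ?_ ?_ ?_
    · obtain ⟨q, hq⟩ := G.nonempty
      exact ⟨q, q, hq, le_rfl⟩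
    · rintro x ⟨q, hq, hqx⟩ y ⟨r, hr, hry⟩
      obtain ⟨s, hs, hsq, hsr⟩ := G.directed q hq r hr
      exact ⟨s, ⟨s, hs, le_rfl⟩, le_trans hsq hqx, le_trans hsr hry⟩
    · rintro x y hxy ⟨q, hq, hqx⟩
      exact ⟨q, hq, hqx.trans hxy⟩
  refine ⟨hF.toPFilter, fun D hDm => ?_⟩
  obtain ⟨q, hqG, hqD⟩ := hG _ ⟨⟨D, hDm⟩, rfl⟩
  exact ⟨q, ⟨q, hqG, le_rfl⟩, hqD⟩

end PosetProp

theorem theorem1p3 (n : ℕ) (hn : 2 ≤ n) :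
    (PosetProp.Implies.{u} (PosetProp.SigmaLinked n) (PosetProp.Knaster (n + 1)) →
      PosetProp.MartinAxiomOmegaOne.{u} (PosetProp.SigmaLinked n)) ∧
    (PosetProp.ImpliesOmegaOne.{u} (PosetProp.SigmaLinked n) (PosetProp.SigmaLinked (n + 1)) →
      PosetProp.MartinAxiomOmegaOne.{u} (PosetProp.SigmaLinked n)) :=
  ⟨fun h => h.knasterOmegaOne.martinAxiomOmegaOne hn,
    fun h => h.knasterOmegaOne.martinAxiomOmegaOne hn⟩
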